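/- For $a\in\mathbb{N}$, real $\alpha>0$, $\eta>0$ and $\mu,p,b,c\in\mathbb{C}$ let $${}_a\mathcal{W}^{\alpha,\mu}_{p,b,c,\eta}(z)=\sum_{k=0}^{\infty}\frac{(-c)^k}{\Gamma(\alpha k+\mu)\,\Gamma\!\left(ak+\frac p\eta+\frac{b+2}{2}\right)}\left(\frac z2\right)^{2k+p+1}$$ be the generalized Struve function. For $\Re\gamma>0$ and $x>0$ let $$\left(I_{0+}^{\lambda,\lambda',\xi,\xi',\gamma}f\right)(x)=\frac{x^{-\lambda}}{\Gamma(\gamma)}\int_0^x (x-t)^{\gamma-1}t^{-\lambda'}F_3\!\left(\lambda,\lambda',\xi,\xi';\gamma;1-\tfrac tx,1-\tfrac xt\right)f(t)\,dt,$$ where $F_3$ is the (analytically continued) Appell function, $F_3(a,a',b,b';c;x,y)=\sum_{m,n\ge0}\frac{(a)_m(a')_n(b)_m(b')_n}{(c)_{m+n}\,m!\,n!}x^my^n$ for $|x|,|y|<1$, and let $$\left(D_{0+}^{\lambda,\lambda',\xi,\xi',\gamma}f\right)(x)=\left(\frac{d}{dx}\right)^{n}\left(I_{0+}^{-\lambda',-\lambda,-\xi'+n,-\xi,-\gamma+n}f\right)(x),\qquad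 n=[\Re\gamma]+1,$$ be the left-sided Marichev–Saigo–Maeda fractional derivative. Finally let $${}_r\Psi_s\!\left[\begin{matrix}(a_i,\alpha_i)_{1,r}\\(b_j,\beta_j)_{1,s}\end{matrix}\,\middle|\,z\right]=\sum_{k=0}^\infty\frac{\prod_{i=1}^r\Gamma(a_i+\alpha_ik)}{\prod_{j=1}^s\Gamma(b_j+\beta_jk)}\frac{z^k}{k!}$$ be the Fox–Wright function ($1/\Gamma$ is $0$ at the poles of $\Gamma$). Theorem. Let $\lambda,\lambda',\xi,\xi',\gamma,\rho,p,b,c,\mu\in\mathbb{C}$ with $\Re\gamma>0$, $a\in\mathbb{N}$, $\alpha,\eta>0$ and $x>0$. Then $$\left(D_{0+}^{\lambda,\lambda',\xi,\xi',\gamma}\,t^{\rho-1}{}_a\mathcal{W}^{\alpha,\mu}_{p,b,c,\eta}(t)\right)(x)=\frac{x^{\lambda+\lambda'-\gamma+\rho+p}}{2^{p+1}}\;{}_4\Psi_5\!\left[\begin{matrix}(1,1),\,(\rho+p+1,2),\,(-\xi+\lambda+\rho+p+1,2),\,(\lambda+\lambda'+\xi'-\gamma+\rho+p+1,2)\\(\mu,\alpha),\,\left(\frac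 p\eta+\frac{b+2}{2},a\right),\,(-\xi+\rho+p+1,2),\,(\lambda+\lambda'-\gamma+\rho+p+1,2),\,(\lambda+\xi'-\gamma+\rho+p+1,2)\end{matrix}\,\middle|\,-\frac{cx^2}{4}\right],$$ provided both sides exist, that is: the integral defining $I_{0+}^{-\lambda',-\lambda,-\xi'+n,-\xi,-\gamma+n}$ of $t^{\rho-1}{}_a\mathcal{W}^{\alpha,\mu}_{p,b,c,\eta}(t)$ converges absolutely at all points of a neighbourhood of $x$, and none of the Gamma functions in the numerators of the Fox–Wright series is evaluated at a pole. (The $n$-fold differentiability at $x$ and the convergence of the Fox–Wright series then hold automatically and are part of the claim.) -/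

import Mathlib

open Filter Topology

noncomputable section

/-- The Gauss hypergeometric function `₂F₁(a, b; c; z)`: the power series on the unit disc, and
its analytic continuation `(1 - z)^(-a) ₂F₁(a, c - b; c; z / (z - 1))` at the points of the
half-plane `Re z < 1/2` outside the disc (only such points are ever used). -/
def gaussF (a b c z : ℂ) : ℂ :=
  open Classical in
  if ‖z‖ < 1 then ordinaryHypergeometric a b c z
  else (1 - z) ^ (-a) * ordinaryHypergeometric a (c - b) c (z / (z - 1))

/-- The Appell function `F₃(a, a', b, b'; c; x, y)` for `|x| < 1`. The double series
`∑ₘ ∑ₙ (a)ₘ (a')ₙ (b)ₘ (b')ₙ / ((c)ₘ₊ₙ m! n!) xᵐ yⁿ` is summed over `n` first, using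
`(c)ₘ₊ₙ = (c)ₘ (c + m)ₙ`; the inner sum is a Gauss function of `y`, which continues `F₃`
analytically in `y`, in particular to all real `y < 1`. -/
def appellF3 (a a' b b' c x y : ℂ) : ℂ :=
  ∑' m : ℕ, (ascPochhammer ℂ m).eval a * (ascPochhammer ℂ m).eval b /
    ((ascPochhammer ℂ m).eval c * (m.factorial : ℂ)) * x ^ m * gaussF a' b' (c + m) y

/-- Inside the bidisc `appellF3` is the double series that defines the Appell function. -/
theorem appellF3_eq_series (a a' b b' c x y : ℂ) (hy : ‖y‖ < 1) :
    appellF3 a a' b b' c x y =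
      ∑' (m : ℕ) (n : ℕ),
        (ascPochhammer ℂ m).eval a * (ascPochhammer ℂ n).eval a' *
          (ascPochhammer ℂ m).eval b * (ascPochhammer ℂ n).eval b' /
          ((ascPochhammer ℂ (m + n)).eval c * (m.factorial : ℂ) * (n.factorial : ℂ)) *
          x ^ m * y ^ n := by
  unfold appellF3 gaussF
  refine tsum_congr fun m => ?_
  rw [if_pos hy, ordinaryHypergeometric_eq_tsum, ← tsum_mul_left]
  refine tsum_congr fun n => ?_
  have h : (ascPochhammer ℂ (m + n)).eval c =
      (ascPochhammer ℂ m).eval c * (ascPochhammer ℂ n).eval (c + m) := by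
    rw [← ascPochhammer_mul]
    simp
  rw [h]
  simp only [smul_eq_mul, div_eq_mul_inv, mul_inv]
  ring

/-- The integrand of the left-sided Marichev–Saigo–Maeda integral at the point `x`. -/
def msmIntegrand (l l' ξ ξ' γ : ℂ) (f : ℝ → ℂ) (x t : ℝ) : ℂ :=
  ((x - t : ℝ) : ℂ) ^ (γ - 1) * (t : ℂ) ^ (-l') *
    appellF3 l l' ξ ξ' γ ((1 - t / x : ℝ) : ℂ) ((1 - x / t : ℝ) : ℂ) * f t

/-- The integral that defines the left-sided Marichev–Saigo–Maeda integral of `f` at `x`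
converges. -/
def MSMIntegralExists (l l' ξ ξ' γ : ℂ) (f : ℝ → ℂ) (x : ℝ) : Prop :=
  MeasureTheory.IntegrableOn (msmIntegrand l l' ξ ξ' γ f x) (Set.Ioo 0 x)

/-- The left-sided Marichev–Saigo–Maeda fractional integral `I_{0+}^{l, l', ξ, ξ', γ} f`. -/
def msmIntegral (l l' ξ ξ' γ : ℂ) (f : ℝ → ℂ) (x : ℝ) : ℂ :=
  (x : ℂ) ^ (-l) / Complex.Gamma γ * ∫ t in Set.Ioo 0 x, msmIntegrand l l' ξ ξ' γ f x t

/-- The order `[Re γ] + 1` of the outer derivative in `D_{0+}^{l, l', ξ, ξ', γ}`. -/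
def msmOrder (γ : ℂ) : ℕ := ⌊γ.re⌋₊ + 1

/-- The fractional integral `I_{0+}^{-l', -l, -ξ' + n, -ξ, -γ + n} f`, `n = [Re γ] + 1`,
whose `n`-th derivative is `D_{0+}^{l, l', ξ, ξ', γ} f`. -/
def msmDerivInner (l l' ξ ξ' γ : ℂ) (f : ℝ → ℂ) (x : ℝ) : ℂ :=
  msmIntegral (-l') (-l) (-ξ' + msmOrder γ) (-ξ) (-γ + msmOrder γ) f x

/-- Convergence at `x` of the integral in `msmDerivInner`. -/
def MSMDerivInnerExists (l l' ξ ξ' γ : ℂ) (f : ℝ → ℂ) (x : ℝ) : Prop :=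
  MSMIntegralExists (-l') (-l) (-ξ' + msmOrder γ) (-ξ) (-γ + msmOrder γ) f x

/-- The left-sided Marichev–Saigo–Maeda fractional derivative `D_{0+}^{l, l', ξ, ξ', γ} f`. -/
def msmDeriv (l l' ξ ξ' γ : ℂ) (f : ℝ → ℂ) (x : ℝ) : ℂ :=
  iteratedDeriv (msmOrder γ) (msmDerivInner l l' ξ ξ' γ f) x

/-- The generalized Struve function `ₐW_{p,b,c,η}^{α,μ}(z)`. (A factor `1 / Γ` at a pole of `Γ`
is `0`, in agreement with `Complex.Gamma` being `0` there.) -/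
def genStruve (a : ℕ) (α : ℝ) (μ p b c : ℂ) (η : ℝ) (z : ℂ) : ℂ :=
  ∑' k : ℕ, (-c) ^ k /
    (Complex.Gamma (α * k + μ) * Complex.Gamma (a * k + p / η + (b + 2) / 2)) *
    (z / 2) ^ (2 * k + p + 1)

/-- The `k`-th term of the Fox–Wright series with upper parameters `A` and lower parameters `B`,
each a pair (shift, slope). -/
def foxWrightTerm {m n : ℕ} (A : Fin m → ℂ × ℝ) (B : Fin n → ℂ × ℝ) (z : ℂ) (k : ℕ) : ℂ :=
  (∏ i, Complex.Gamma ((A i).1 + (A i).2 * k)) / (∏ j, Complex.Gamma ((B j).1 + (B j).2 * k)) *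
    (z ^ k / (k.factorial : ℂ))

/-- No Gamma factor in a numerator of the Fox–Wright series is taken at a pole. -/
def FoxWrightTermsExist {m : ℕ} (A : Fin m → ℂ × ℝ) : Prop :=
  ∀ (i : Fin m) (k j : ℕ), (A i).1 + (A i).2 * k ≠ -(j : ℂ)

/-- The Fox–Wright function `ₘΨₙ`. -/
def foxWright {m n : ℕ} (A : Fin m → ℂ × ℝ) (B : Fin n → ℂ × ℝ) (z : ℂ) : ℂ :=
  ∑' k : ℕ, foxWrightTerm A B z k

/-- The upper parameters of the Fox–Wright function in the image formula. -/
def upperParams (l l' ξ ξ' γ ρ p : ℂ) : Fin 4 → ℂ × ℝ :=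
  ![(1, 1), (ρ + p + 1, 2), (-ξ + l + ρ + p + 1, 2), (l + l' + ξ' - γ + ρ + p + 1, 2)]

/-- The lower parameters of the Fox–Wright function in the image formula. -/
def lowerParams (l l' ξ ξ' γ ρ p b μ : ℂ) (α η : ℝ) (a : ℕ) : Fin 5 → ℂ × ℝ :=
  ![(μ, α), (p / η + (b + 2) / 2, a), (-ξ + ρ + p + 1, 2), (l + l' - γ + ρ + p + 1, 2),
    (l + ξ' - γ + ρ + p + 1, 2)]

end

/-! After the substitution `t = y u`, the fractional integral at `y` is a power of `y` times `∫₀¹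
K(u) f(y u) du`, where `K` is the kernel at `x = 1` (`msmKernel`). Here `f` is `t ^ (ρ + p)` times
an entire series in `t ^ 2`, entire because `1 / Γ(α k + μ)` decays faster than any geometric
sequence. Termwise integration therefore leaves only the Mellin transform `∫₀¹ u ^ (s - 1) K(u) du`
at `s = ρ + p + 1 + 2 k`. It equals `Γ(G)`, `G = -γ + n`, times a quotient of three Gamma values by
three. Differentiating a power of `y` `n` times produces a rising factorial, which removes the shift
by `n` from the only denominator Gamma that carries it; what is left is the Fox–Wright term.

The Mellin transform is computed for large `Re s`. Pfaff's transformation turns the continued Appell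
function into a double series in powers of `1 - u` (`appellF3_eq_tsum_appellCoeff`); each term is a
beta integral, and the two summations are both instances of Gauss's theorem
(`hasSum_gaussCoeff_one`). Multiplied by the reciprocal numerator Gammas, the formula becomes an
equality of analytic functions, which extends to every closed half-plane `Re s ≥ r` on whose edge
the integral converges absolutely (`integral_msmKernel_mul`).

No parameter condition for convergence is imposed, so it must be recovered from the existence of the
integral of the whole `f`. Near `0` the series behaves like its lowest nonvanishing term, hence that
power is integrable against `K`, and all higher powers are smaller on `(0, 1)`
(`exists_integrableOn_cpow_mul_of_series`). -/

/-- The rising factorial `(a)ₙ = a (a + 1) ⋯ (a + n - 1)`. -/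
noncomputable def poch {R : Type*} [CommRing R] (a : R) (n : ℕ) : R := (ascPochhammer R n).eval a

/-! ### Rising factorials: estimates and the Chu–Vandermonde sum. -/

section Pochhammer

variable {R : Type*} [CommRing R]

@[simp] theorem poch_zero (a : R) : poch a 0 = 1 := by simp [poch]

theorem poch_succ (a : R) (n : ℕ) : poch a (n + 1) = poch a n * (a + n) := by
  simp [poch, ascPochhammer_succ_eval]

theorem poch_add (a : R) (m n : ℕ) : poch a (m + n) = poch a m * poch (a + m) n := by
  simp [poch, ← ascPochhammer_mul]

theorem poch_succ' (a : R) (n : ℕ) : poch a (n + 1) = a * poch (a + 1) n := by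
  rw [add_comm, poch_add]; simp [poch_succ]

theorem poch_one_left (n : ℕ) : poch (1 : R) n = n.factorial := by
  simp [poch, ascPochhammer_eval_one]

theorem poch_nonneg {r : ℝ} (hr : 0 ≤ r) (n : ℕ) : 0 ≤ poch r n := by
  induction n with
  | zero => simp
  | succ n ih => rw [poch_succ]; positivity

theorem poch_pos {r : ℝ} (hr : 0 < r) (n : ℕ) : 0 < poch r n := ascPochhammer_pos n r hr

theorem poch_mono {r s : ℝ} (hr : 0 ≤ r) (h : r ≤ s) (n : ℕ) : poch r n ≤ poch s n := by
  induction n with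
  | zero => simp
  | succ n ih =>
    rw [poch_succ, poch_succ]
    exact mul_le_mul ih (by linarith) (by positivity) (poch_nonneg (hr.trans h) n)

theorem norm_poch_le {a : ℂ} {r : ℝ} (h : ‖a‖ ≤ r) (n : ℕ) : ‖poch a n‖ ≤ poch r n := by
  induction n with
  | zero => simp
  | succ n ih =>
    rw [poch_succ, poch_succ, norm_mul]
    refine mul_le_mul ih ((norm_add_le _ _).trans ?_) (norm_nonneg _)
      (poch_nonneg ((norm_nonneg a).trans h) n)
    simpa using h

theorem poch_le_norm_poch {a : ℂ} {r : ℝ} (hr : 0 ≤ r) (h : r ≤ a.re) (n : ℕ) :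
    poch r n ≤ ‖poch a n‖ := by
  induction n with
  | zero => simp
  | succ n ih =>
    rw [poch_succ, poch_succ, norm_mul]
    refine mul_le_mul ih ?_ (by positivity) (norm_nonneg _)
    refine le_trans ?_ (Complex.re_le_norm _)
    simpa using h

theorem poch_ne_zero {a : ℂ} (h : 0 < a.re) (n : ℕ) : poch a n ≠ 0 := by
  have := (poch_pos h n).trans_le (poch_le_norm_poch h.le le_rfl n)
  exact norm_pos_iff.1 this

theorem Gamma_add_nat_eq_poch_mul {a : ℂ} (h : 0 < a.re) (n : ℕ) :
    Complex.Gamma (a + n) = poch a n * Complex.Gamma a := by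
  induction n with
  | zero => simp
  | succ n ih =>
    have h0 : a + n ≠ 0 := by
      intro h0
      have := congrArg Complex.re h0
      simp at this
      have : (0 : ℝ) ≤ n := by positivity
      linarith
    rw [poch_succ, Nat.cast_succ, ← add_assoc, Complex.Gamma_add_one _ h0, ih]
    ring

theorem Gamma_inv_eq_poch_mul (a : ℂ) (n : ℕ) :
    (Complex.Gamma a)⁻¹ = poch a n * (Complex.Gamma (a + n))⁻¹ := by
  induction n with
  | zero => simp
  | succ n ih =>
    rw [ih, Complex.one_div_Gamma_eq_self_mul_one_div_Gamma_add_one (a + n), poch_succ]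
    push_cast
    ring_nf

theorem poch_nat_succ_le (A n : ℕ) :
    poch ((A : ℝ) + 1) n ≤ n.factorial * ((n : ℝ) + 1) ^ A := by
  induction A with
  | zero => simp [poch_one_left]
  | succ A ih =>
    have h : ((A : ℝ) + 1) * poch ((A : ℝ) + 1 + 1) n = poch ((A : ℝ) + 1) n * (A + 1 + n) := by
      rw [← poch_succ', poch_succ]
    have h2 : poch ((A : ℝ) + 1 + 1) n ≤ poch ((A : ℝ) + 1) n * (n + 1) := by
      have hA : (0 : ℝ) < (A : ℝ) + 1 := by positivity
      refine le_of_mul_le_mul_left ?_ hA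
      rw [h]
      have h3 := poch_nonneg hA.le n
      have : (A : ℝ) + 1 + n ≤ (A + 1) * (n + 1) := by
        nlinarith [mul_nonneg (Nat.cast_nonneg (α := ℝ) A) (Nat.cast_nonneg (α := ℝ) n)]
      nlinarith
    push_cast
    calc _ ≤ _ := h2
      _ ≤ n.factorial * ((n : ℝ) + 1) ^ A * (n + 1) := by gcongr
      _ = _ := by ring

/-- Raising the base by `T` gains `T` powers of `n`: both `(A+1)_T (A+1+T)_n` and `(A+1)_n
(A+1+n)_T` equal `(A+1)_(n+T)`, and every factor of `(A+1+n)_T` is at least `n + 1`. -/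
theorem pow_mul_poch_le (A T n : ℕ) :
    ((n : ℝ) + 1) ^ T * poch ((A : ℝ) + 1) n ≤
      poch ((A : ℝ) + 1) T * poch ((A : ℝ) + 1 + T) n := by
  rw [← poch_add, add_comm T n, poch_add, mul_comm]
  refine mul_le_mul_of_nonneg_left ?_ (poch_nonneg (by positivity) n)
  have : (0 : ℝ) ≤ A := by positivity
  generalize hr : (A : ℝ) + 1 + n = r
  have hr : (n : ℝ) + 1 ≤ r := by linarith
  induction T with
  | zero => simp
  | succ T ih =>
    rw [pow_succ, poch_succ]
    refine mul_le_mul ih ?_ (by positivity) (poch_nonneg (le_trans (by positivity) hr) T)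
    have : (0 : ℝ) ≤ T := by positivity
    linarith

/-- The Chu–Vandermonde summation. -/
theorem sum_choose_poch_div (N : ℕ) : ∀ {c : ℂ} (d : ℂ), 0 < c.re →
    ∑ n ∈ Finset.range (N + 1), (-1) ^ n * (N.choose n : ℂ) * poch d n / poch c n =
      poch (c - d) N / poch c N := by
  induction N with
  | zero => intro c d hc; simp
  | succ N ih =>
    intro c d hc
    have hc1 : 0 < (c + 1).re := by simp; linarith
    have hc0 : c ≠ 0 := by rintro rfl; simp at hc
    have h1 := ih d hc
    have h2 := ih (d + 1) hc1
    -- Pascal's rule splits the sum for `N + 1` into the sums for `(d, c)` and `(d + 1, c + 1)`;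
    -- both have the same difference `c - d`.
    have key : ∑ n ∈ Finset.range (N + 1 + 1),
        (-1) ^ n * ((N + 1).choose n : ℂ) * poch d n / poch c n =
        (∑ n ∈ Finset.range (N + 1), (-1) ^ n * (N.choose n : ℂ) * poch d n / poch c n) -
        d / c * ∑ n ∈ Finset.range (N + 1), (-1) ^ n * (N.choose n : ℂ) * poch (d + 1) n /
          poch (c + 1) n := by
      rw [Finset.sum_range_succ']
      have e : ∀ n, (-1 : ℂ) ^ (n + 1) * ((N + 1).choose (n + 1) : ℂ) * poch d (n + 1) /
          poch c (n + 1) = (-1) ^ (n + 1) * (N.choose (n + 1) : ℂ) * poch d (n + 1) /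
          poch c (n + 1) - d / c * ((-1) ^ n * (N.choose n : ℂ) * poch (d + 1) n /
          poch (c + 1) n) := by
        intro n
        have := poch_ne_zero hc1 n
        rw [Nat.choose_succ_succ, poch_succ' d, poch_succ' c]
        push_cast
        field_simp
        ring
      simp only [e, Finset.sum_sub_distrib, ← Finset.mul_sum]
      have e2 := Finset.sum_range_succ' (fun n => (-1 : ℂ) ^ n * (N.choose n : ℂ) * poch d n /
        poch c n) (N + 1)
      rw [Finset.sum_range_succ] at e2
      simp only [Nat.choose_succ_self, Nat.cast_zero, mul_zero, zero_mul, zero_div, add_zero]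
        at e2
      rw [e2]
      simp
      ring
    rw [key, h1, h2, add_sub_add_right_eq_sub, poch_succ, poch_succ]
    have h3 := poch_ne_zero hc N
    have h4 := poch_ne_zero hc1 N
    have h5 : c * poch (c + 1) N = poch c N * (c + N) := by rw [← poch_succ', poch_succ]
    have h6 := poch_ne_zero hc (N + 1)
    rw [poch_succ] at h6
    have h7 : c + (N : ℂ) ≠ 0 := right_ne_zero_of_mul h6
    have h8 : d / c * (poch (c - d) N / poch (c + 1) N) =
        d * poch (c - d) N / (poch c N * (c + N)) := by
      rw [← h5]; field_simp
    rw [h8]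
    field_simp
    ring

end Pochhammer

/-! ### The Gauss series, the binomial series and Pfaff's transformation. -/

section Gauss

theorem hasSum_sum_antidiagonal {F : ℕ × ℕ → ℂ} {S : ℂ} (h : HasSum F S) :
    HasSum (fun N => ∑ p ∈ Finset.HasAntidiagonal.antidiagonal N, F p) S := by
  have h1 := (Finset.HasAntidiagonal.sigmaAntidiagonalEquivProd (A := ℕ)).hasSum_iff.2 h
  refine h1.sigma fun N => ?_
  have := hasSum_fintype (fun p : Finset.HasAntidiagonal.antidiagonal N => F p)
  rwa [Finset.univ_eq_attach, Finset.sum_attach _ F] at this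

/-- The coefficients of the Gauss hypergeometric series. -/
noncomputable def gaussCoeff (a b c : ℂ) (n : ℕ) : ℂ :=
  poch a n * poch b n / (poch c n * n.factorial)

theorem gaussCoeff_eq (a b c : ℂ) : gaussCoeff a b c = ordinaryHypergeometricCoefficient a b c := by
  ext n
  simp only [gaussCoeff, poch, ordinaryHypergeometricCoefficient, div_eq_mul_inv, mul_inv]
  ring

theorem one_le_radius_ordinaryHypergeometricSeries (a b : ℂ) {c : ℂ} (hc : 0 < c.re) :
    1 ≤ (ordinaryHypergeometricSeries ℂ a b c).radius := by
  -- If `a` or `b` is a nonpositive integer the series terminates and the radius is infinite;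
  -- otherwise it is exactly `1`.
  by_cases ha : ∃ k : ℕ, (k : ℂ) = -a
  · obtain ⟨k, hk⟩ := ha
    rw [show a = -(k : ℂ) by rw [hk, neg_neg], ordinaryHypergeometric_radius_top_of_neg_nat₁]
    exact le_top
  by_cases hb : ∃ k : ℕ, (k : ℂ) = -b
  · obtain ⟨k, hk⟩ := hb
    rw [show b = -(k : ℂ) by rw [hk, neg_neg], ordinaryHypergeometric_radius_top_of_neg_nat₂]
    exact le_top
  push Not at ha hb
  rw [ordinaryHypergeometricSeries_radius_eq_one]
  refine fun k => ⟨ha k, hb k, fun h => ?_⟩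
  have := congrArg Complex.re h
  simp at this
  have : (0 : ℝ) ≤ k := by positivity
  linarith

theorem summable_norm_gaussCoeff (a b : ℂ) {c : ℂ} (hc : 0 < c.re) {r : ℝ} (h0 : 0 ≤ r)
    (hr : r < 1) : Summable fun n => ‖gaussCoeff a b c n‖ * r ^ n := by
  lift r to NNReal using h0
  have h := (ordinaryHypergeometricSeries ℂ a b c).summable_norm_mul_pow (r := r)
    (lt_of_lt_of_le (by exact_mod_cast hr) (one_le_radius_ordinaryHypergeometricSeries a b hc))
  refine h.congr fun n => ?_
  rw [ordinaryHypergeometricSeries, FormalMultilinearSeries.ofScalars_norm, gaussCoeff_eq]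

theorem hasSum_gaussCoeff (a b : ℂ) {c : ℂ} (hc : 0 < c.re) {z : ℂ} (hz : ‖z‖ < 1) :
    HasSum (fun n => gaussCoeff a b c n * z ^ n) (ordinaryHypergeometric a b c z) := by
  have hs : Summable (fun n => gaussCoeff a b c n * z ^ n) := by
    refine Summable.of_norm ?_
    simpa using summable_norm_gaussCoeff a b hc (norm_nonneg z) hz
  convert hs.hasSum using 1
  rw [ordinaryHypergeometric_eq_tsum, gaussCoeff_eq]
  rfl

theorem analyticOnNhd_ordinaryHypergeometric (a b : ℂ) {c : ℂ} (hc : 0 < c.re) :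
    AnalyticOnNhd ℂ (ordinaryHypergeometric a b c) (Metric.ball (0 : ℂ) 1) := by
  have h1 := one_le_radius_ordinaryHypergeometricSeries a b hc
  have h := ((ordinaryHypergeometricSeries ℂ a b c).hasFPowerSeriesOnBall
    (lt_of_lt_of_le one_pos h1)).mono one_pos h1
  have := h.analyticOnNhd
  rwa [← ENNReal.ofReal_one, Metric.eball_ofReal] at this

theorem hasSum_poch_div_factorial (a : ℂ) {x : ℂ} (hx : ‖x‖ < 1) :
    HasSum (fun n : ℕ => poch a n / n.factorial * x ^ n) ((1 - x) ^ (-a)) := by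
  have h := (Complex.one_div_one_sub_cpow_hasFPowerSeriesOnBall_zero a).hasSum (y := x) (by
    rw [← ENNReal.ofReal_one, Metric.eball_ofReal]; simpa using hx)
  rw [zero_add, one_div, ← Complex.cpow_neg] at h
  refine Eq.mp (congrArg (fun f => HasSum f _) (funext fun n => ?_)) h
  symm
  rw [FormalMultilinearSeries.ofScalars_apply_eq, smul_eq_mul]
  congr 1
  have h2 : Ring.choose (a + n - 1) n = Ring.multichoose a n := by
    rw [Ring.choose]; congr 1; ring
  have h3 := Ring.factorial_nsmul_multichoose_eq_ascPochhammer a n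
  rw [Polynomial.ascPochhammer_smeval_eq_eval, nsmul_eq_mul] at h3
  rw [h2, poch, ← h3, mul_div_cancel_left₀ _ (Nat.cast_ne_zero.2 n.factorial_ne_zero)]

theorem hasSum_real_poch_div_factorial (a : ℝ) {x : ℝ} (h0 : 0 ≤ x) (hx : x < 1) :
    HasSum (fun n : ℕ => poch a n / n.factorial * x ^ n) ((1 - x) ^ (-a)) := by
  have h := hasSum_poch_div_factorial a (x := x) (by simpa [abs_of_nonneg h0] using hx)
  have e : ((1 : ℂ) - x) ^ (-(a : ℂ)) = (((1 - x) ^ (-a) : ℝ) : ℂ) := by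
    rw [Complex.ofReal_cpow (by linarith)]; push_cast; rfl
  rw [e] at h
  have e2 : (fun n : ℕ => poch (a : ℂ) n / n.factorial * (x : ℂ) ^ n) =
      fun n : ℕ => ((poch a n / n.factorial * x ^ n : ℝ) : ℂ) := by
    ext n
    have : poch (a : ℂ) n = ((poch a n : ℝ) : ℂ) := by
      induction n with
      | zero => simp
      | succ n ih => rw [poch_succ, poch_succ, ih]; push_cast; rfl
    rw [this]; push_cast; rfl
  rw [e2] at h
  exact Complex.hasSum_ofReal.1 h

theorem norm_poch_ofReal {r : ℝ} (hr : 0 ≤ r) (n : ℕ) : ‖poch (r : ℂ) n‖ = poch r n :=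
  le_antisymm (norm_poch_le (by simp [abs_of_nonneg hr]) n) (poch_le_norm_poch hr (by simp) n)

/-- Replacing `a` by `‖a‖` gives a majorant whose inner sum is the binomial `(1 - ‖y‖) ^ (-‖a‖ -
n)`. The outer sum is then a Gauss series at `‖y‖ / (1 - ‖y‖)`, which is below `1` since `‖y‖ <
1/4`. -/
theorem summable_pfaff_family (a d : ℂ) {c : ℂ} (hc : 0 < c.re) {y : ℂ} (hy : ‖y‖ < 1 / 4) :
    Summable fun p : ℕ × ℕ => gaussCoeff a d c p.1 * (-1) ^ p.1 *
      (poch (a + p.1) p.2 / p.2.factorial) * y ^ (p.1 + p.2) := by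
  have hy1 : ‖y‖ < 1 := by linarith
  have hA : (0 : ℝ) ≤ ‖a‖ := norm_nonneg a
  have hr0 : (0 : ℝ) ≤ ‖y‖ := norm_nonneg y
  have hr1 : 0 < 1 - ‖y‖ := by linarith
  refine Summable.of_norm_bounded (g := fun p : ℕ × ℕ =>
    ‖gaussCoeff ‖a‖ d c p.1‖ * ‖y‖ ^ p.1 * (poch (‖a‖ + p.1) p.2 / p.2.factorial * ‖y‖ ^ p.2))
    ?_ fun p => ?_
  · have hin := fun n : ℕ => hasSum_real_poch_div_factorial (‖a‖ + n) hr0 hy1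
    rw [summable_prod_of_nonneg]
    swap
    · intro p
      have := poch_nonneg (r := ‖a‖ + p.1) (by positivity) p.2
      exact mul_nonneg (by positivity) (mul_nonneg (by positivity) (by positivity))
    constructor
    · intro n
      exact (hin n).summable.mul_left (‖gaussCoeff ‖a‖ d c n‖ * ‖y‖ ^ n)
    · simp only [tsum_mul_left, (hin _).tsum_eq]
      have hs := (summable_norm_gaussCoeff ‖a‖ d hc (r := ‖y‖ / (1 - ‖y‖)) (by positivity)
        (by rw [div_lt_one hr1]; linarith)).mul_right ((1 - ‖y‖) ^ (-‖a‖))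
      refine hs.congr fun n => ?_
      rw [neg_add, Real.rpow_add hr1, Real.rpow_neg hr1.le (n : ℝ), Real.rpow_natCast, div_pow]
      ring
  · have h1 : ‖gaussCoeff a d c p.1‖ ≤ ‖gaussCoeff ‖a‖ d c p.1‖ := by
      simp only [gaussCoeff, norm_mul, norm_div]
      rw [norm_poch_ofReal hA]
      have h1 := norm_poch_le le_rfl (a := a) p.1
      gcongr
    have h2 : ‖poch (a + p.1) p.2‖ ≤ poch (‖a‖ + p.1) p.2 :=
      norm_poch_le ((norm_add_le _ _).trans (by simp)) p.2
    have h4 := poch_nonneg (r := ‖a‖ + p.1) (by positivity) p.2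
    have e : ‖gaussCoeff a d c p.1 * (-1) ^ p.1 *
      (poch (a + p.1) p.2 / p.2.factorial) * y ^ (p.1 + p.2)‖ = ‖gaussCoeff a d c p.1‖ *
        ‖y‖ ^ p.1 * (‖poch (a + p.1) p.2‖ / p.2.factorial * ‖y‖ ^ p.2) := by
      simp only [norm_mul, norm_div, norm_pow, norm_neg, norm_one, one_pow, mul_one,
        Complex.norm_natCast, pow_add]
      ring
    rw [e]
    gcongr

/-- Expanding each `(1 - y) ^ (-a - n)` on the right by the binomial series and collecting the
coefficient of `y ^ N` leaves a Chu–Vandermonde sum. The ball is small so that the double series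
converges absolutely. -/
theorem pfaff_near_zero (a b : ℂ) {c : ℂ} (hc : 0 < c.re) {y : ℂ} (hy : ‖y‖ < 1 / 4) :
    ordinaryHypergeometric a b c y =
      (1 - y) ^ (-a) * ordinaryHypergeometric a (c - b) c (y / (y - 1)) := by
  set F : ℕ × ℕ → ℂ := fun p => gaussCoeff a (c - b) c p.1 * (-1) ^ p.1 *
    (poch (a + p.1) p.2 / p.2.factorial) * y ^ (p.1 + p.2) with hF
  have hy1 : ‖y‖ < 1 := by linarith
  have h1y : (1 - y) ≠ 0 := by
    intro h
    rw [show y = 1 by linear_combination -h] at hy1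
    simp at hy1
  have hyn : 3 / 4 ≤ ‖y - 1‖ := by
    have := norm_sub_norm_le 1 y
    rw [norm_sub_rev]
    simp at this
    linarith
  have hz : ‖y / (y - 1)‖ < 1 := by
    rw [norm_div, div_lt_one (by linarith)]
    linarith
  have hsum : Summable F := summable_pfaff_family a (c - b) hc hy
  have hR : ∑' p, F p =
      (1 - y) ^ (-a) * ordinaryHypergeometric a (c - b) c (y / (y - 1)) := by
    rw [hsum.tsum_prod, ← (hasSum_gaussCoeff a (c - b) hc hz).tsum_eq, ← tsum_mul_left]
    refine tsum_congr fun n => ?_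
    have h := (hasSum_poch_div_factorial (a + n) hy1).mul_left
      (gaussCoeff a (c - b) c n * (-1) ^ n * y ^ n)
    rw [show (fun j => F (n, j)) = fun j : ℕ => gaussCoeff a (c - b) c n * (-1) ^ n * y ^ n *
      (poch (a + n) j / j.factorial * y ^ j) by ext j; simp only [hF, pow_add]; ring, h.tsum_eq,
      neg_add, Complex.cpow_add _ _ h1y, Complex.cpow_neg _ (n : ℂ), Complex.cpow_natCast, div_pow,
      show y - 1 = -1 * (1 - y) by ring, mul_pow]
    have h4 : (-1 : ℂ) ^ n * (-1) ^ n = 1 := by rw [← mul_pow]; simp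
    field_simp
    linear_combination (gaussCoeff a (c - b) c n * y ^ n * (1 - y) ^ (-a)) * h4
  have hL := hasSum_sum_antidiagonal hsum.hasSum
  rw [← hR]
  refine HasSum.unique ?_ hL
  convert hasSum_gaussCoeff a b hc hy1 using 2 with N
  rw [Finset.Nat.sum_antidiagonal_eq_sum_range_succ_mk]
  have hCV := sum_choose_poch_div N (c - b) hc
  rw [sub_sub_cancel] at hCV
  have hN : (N.factorial : ℂ) ≠ 0 := by exact_mod_cast N.factorial_ne_zero
  rw [show gaussCoeff a b c N = poch a N / N.factorial * (poch b N / poch c N) by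
    rw [gaussCoeff]; have := poch_ne_zero hc N; field_simp, ← hCV, Finset.mul_sum, Finset.sum_mul]
  refine Finset.sum_congr rfl fun n hn => ?_
  have hn : n ≤ N := by simpa [Nat.lt_succ_iff] using hn
  have hnN : n + (N - n) = N := by omega
  simp only [hF, hnN, gaussCoeff]
  have h5 : poch a N = poch a n * poch (a + n) (N - n) := by rw [← poch_add, hnN]
  rw [h5, Nat.cast_choose ℂ hn]
  have := poch_ne_zero hc n
  have h6 : (n.factorial : ℂ) ≠ 0 := by exact_mod_cast n.factorial_ne_zero
  have h7 : ((N - n).factorial : ℂ) ≠ 0 := by exact_mod_cast (N - n).factorial_ne_zero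
  field_simp

/-- The Pfaff transformation. -/
theorem pfaff (a b : ℂ) {c : ℂ} (hc : 0 < c.re) {y : ℂ} (hy : ‖y‖ < 1) (hy2 : y.re < 1 / 2) :
    ordinaryHypergeometric a b c y =
      (1 - y) ^ (-a) * ordinaryHypergeometric a (c - b) c (y / (y - 1)) := by
  -- The identity theorem on this convex set extends the equality from a ball around `0`; on it `Re
  -- z < 1/2` means `‖z‖ < ‖z - 1‖`, so the transformed argument stays in the unit disc.
  set U : Set ℂ := Metric.ball 0 1 ∩ {z | z.re < 1 / 2} with hU
  have hconv : Convex ℝ U := (convex_ball 0 1).inter (convex_halfSpace_re_lt _)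
  have hf : AnalyticOnNhd ℂ (ordinaryHypergeometric a b c) U :=
    (analyticOnNhd_ordinaryHypergeometric a b hc).mono Set.inter_subset_left
  have hslit : ∀ z ∈ U, 1 - z ∈ Complex.slitPlane := by
    intro z hz
    left
    have : z.re < 1 / 2 := hz.2
    simp
    linarith
  have hg : AnalyticOnNhd ℂ (fun y => (1 - y) ^ (-a) *
      ordinaryHypergeometric a (c - b) c (y / (y - 1))) U := by
    intro z hz
    refine AnalyticAt.mul ?_ ?_
    · exact (analyticAt_const.sub analyticAt_id).cpow analyticAt_const (hslit z hz)
    · have hz1 : z - 1 ≠ 0 := by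
        have := Complex.slitPlane_ne_zero (hslit z hz)
        contrapose! this
        linear_combination -this
      have hb : ‖z / (z - 1)‖ < 1 := by
        have h2 : z.re < 1 / 2 := hz.2
        rw [norm_div, div_lt_one (norm_pos_iff.2 hz1), ← sq_lt_sq₀ (norm_nonneg _) (norm_nonneg _),
          Complex.sq_norm, Complex.sq_norm, Complex.normSq_apply, Complex.normSq_apply]
        simp
        nlinarith
      exact AnalyticAt.comp (g := ordinaryHypergeometric a (c - b) c) (f := fun y => y / (y - 1))
        (analyticOnNhd_ordinaryHypergeometric a (c - b) hc _ (by simpa using hb))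
        (analyticAt_id.div (analyticAt_id.sub analyticAt_const) hz1)
  have h0 : (0 : ℂ) ∈ U := by simp [hU]
  refine hf.eqOn_of_preconnected_of_eventuallyEq hg hconv.isPreconnected h0 ?_ ⟨by simpa using hy, hy2⟩
  filter_upwards [Metric.ball_mem_nhds (0 : ℂ) (show (0 : ℝ) < 1 / 4 by norm_num)] with z hz
  exact pfaff_near_zero a b hc (by simpa using hz)

theorem gaussF_one_sub_inv (a b : ℂ) {c : ℂ} (hc : 0 < c.re) {u : ℝ} (h0 : 0 < u) (h1 : u < 1) :
    gaussF a b c ((1 - 1 / u : ℝ) : ℂ) =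
      (u : ℂ) ^ a * ordinaryHypergeometric a (c - b) c ((1 - u : ℝ) : ℂ) := by
  have hu : (u : ℂ) ≠ 0 := by exact_mod_cast h0.ne'
  have e : (1 - ((1 - 1 / u : ℝ) : ℂ)) ^ (-a) *
      ordinaryHypergeometric a (c - b) c (((1 - 1 / u : ℝ) : ℂ) / (((1 - 1 / u : ℝ) : ℂ) - 1)) =
      (u : ℂ) ^ a * ordinaryHypergeometric a (c - b) c ((1 - u : ℝ) : ℂ) := by
    congr 1
    · have : (1 - ((1 - 1 / u : ℝ) : ℂ)) = ((u⁻¹ : ℝ) : ℂ) := by push_cast; ring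
      rw [this, Complex.cpow_neg, Complex.ofReal_inv, Complex.inv_cpow, inv_inv]
      rw [Complex.arg_ofReal_of_nonneg h0.le]
      exact Real.pi_pos.ne
    · congr 1
      push_cast
      have : (1 : ℂ) - 1 / u - 1 = -(u : ℂ)⁻¹ := by rw [one_div]; ring
      rw [this, div_neg, div_inv_eq_mul, sub_mul, one_div, inv_mul_cancel₀ hu]
      ring
  rw [gaussF]
  -- Inside the disc Pfaff applies because `1 - 1 / u < 0`; outside it the transformed expression is
  -- the definition.
  split_ifs with h
  · rw [pfaff a b hc h ?_, e]
    have : 1 < 1 / u := by rw [lt_div_iff₀ h0]; linarith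
    rw [Complex.ofReal_re]
    linarith
  · exact e

end Gauss

/-! ### Gauss's summation theorem at the argument `1`. -/

section GaussSum

/-- The product of `(a₁)_m` and `(d+m)_n` costs `(A+1)_(m+n)`, while `(a₂)_m` and `(a₃)_n` cost
factorials times `((m+1)(n+1)) ^ A`. With the weight and the two inverse squares, `((m+1)(n+1)) ^
(A+3) ≤ (m+n+1) ^ (2(A+3))` has to be absorbed, which `S ≥ A + 1 + 2(A+3) = 3A + 7` does. The weight
is there because the proof of Gauss's theorem needs one extra factor of the index. -/
theorem norm_poch_product_le {A : ℕ} {a₁ a₂ a₃ d : ℂ} (h₁ : ‖a₁‖ ≤ A + 1) (h₂ : ‖a₂‖ ≤ A + 1)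
    (h₃ : ‖a₃‖ ≤ A + 1) (hd : ‖d‖ ≤ A + 1) {S : ℝ} (hS : 3 * A + 7 ≤ S) (m n : ℕ) :
    ((m : ℝ) + 1) * (n + 1) * (‖poch a₁ m‖ * ‖poch a₂ m‖ * ‖poch a₃ n‖ * ‖poch (d + m) n‖ /
        (m.factorial * n.factorial * poch S (m + n))) ≤
      poch ((A : ℝ) + 1) (2 * (A + 3)) * (((m : ℝ) + 1) ^ 2)⁻¹ * (((n : ℝ) + 1) ^ 2)⁻¹ := by
  have hA : (0 : ℝ) ≤ A := by positivity
  have hm : (0 : ℝ) ≤ m := by positivity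
  have hn : (0 : ℝ) ≤ n := by positivity
  have hP := poch_pos (r := S) (by linarith) (m + n)
  have hR := fun k => poch_pos (r := (A : ℝ) + 1) (by positivity) k
  have e1 : ‖poch a₁ m‖ * ‖poch (d + m) n‖ ≤ poch ((A : ℝ) + 1) (m + n) := by
    rw [poch_add]
    refine mul_le_mul (norm_poch_le h₁ m) (norm_poch_le ((norm_add_le _ _).trans ?_) n)
      (norm_nonneg _) (hR m).le
    simpa using hd
  have e2 := (norm_poch_le h₂ m).trans (poch_nat_succ_le A m)
  have e3 := (norm_poch_le h₃ n).trans (poch_nat_succ_le A n)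
  have e4 := pow_mul_poch_le A (2 * (A + 3)) (m + n)
  have e5 : poch ((A : ℝ) + 1 + (2 * (A + 3) : ℕ)) (m + n) ≤ poch S (m + n) :=
    poch_mono (by positivity) (by push_cast; linarith) _
  have e6 : (((m : ℝ) + 1) * (n + 1)) ^ (A + 3) ≤ (((m + n : ℕ) : ℝ) + 1) ^ (2 * (A + 3)) := by
    rw [pow_mul]
    refine pow_le_pow_left₀ (by positivity) ?_ _
    push_cast
    nlinarith [mul_nonneg hm hn]
  have e7 : (((m : ℝ) + 1) * (n + 1)) ^ (A + 3) * poch ((A : ℝ) + 1) (m + n) ≤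
      poch ((A : ℝ) + 1) (2 * (A + 3)) * poch S (m + n) :=
    (mul_le_mul_of_nonneg_right e6 (hR _).le).trans
      (e4.trans (mul_le_mul_of_nonneg_left e5 (hR _).le))
  have e8 : ‖poch a₁ m‖ * ‖poch a₂ m‖ * ‖poch a₃ n‖ * ‖poch (d + m) n‖ ≤
      poch ((A : ℝ) + 1) (m + n) * ((m.factorial * ((m : ℝ) + 1) ^ A) *
        (n.factorial * ((n : ℝ) + 1) ^ A)) := by
    calc _ = ‖poch a₁ m‖ * ‖poch (d + m) n‖ * (‖poch a₂ m‖ * ‖poch a₃ n‖) := by ring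
      _ ≤ _ := by gcongr; exact (hR _).le
  have hm0 : (0 : ℝ) < m.factorial := by exact_mod_cast m.factorial_pos
  have hn0 : (0 : ℝ) < n.factorial := by exact_mod_cast n.factorial_pos
  rw [← mul_div_assoc, div_le_iff₀ (by positivity)]
  refine le_trans (mul_le_mul_of_nonneg_left e8 (by positivity)) ?_
  calc _ = ((((m : ℝ) + 1) * (n + 1)) ^ (A + 3) * poch ((A : ℝ) + 1) (m + n)) *
        ((((m : ℝ) + 1) ^ 2)⁻¹ * (((n : ℝ) + 1) ^ 2)⁻¹ * (m.factorial * n.factorial)) := by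
        rw [mul_pow, pow_add, pow_add]; field_simp
    _ ≤ (poch ((A : ℝ) + 1) (2 * (A + 3)) * poch S (m + n)) *
        ((((m : ℝ) + 1) ^ 2)⁻¹ * (((n : ℝ) + 1) ^ 2)⁻¹ * (m.factorial * n.factorial)) := by
        gcongr
    _ = _ := by ring

theorem summable_norm_poch_product {A : ℕ} {a₁ a₂ a₃ d : ℂ} (h₁ : ‖a₁‖ ≤ A + 1)
    (h₂ : ‖a₂‖ ≤ A + 1) (h₃ : ‖a₃‖ ≤ A + 1) (hd : ‖d‖ ≤ A + 1) {S : ℝ} (hS : 3 * A + 7 ≤ S) :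
    Summable fun p : ℕ × ℕ => ((p.1 : ℝ) + 1) * (p.2 + 1) *
      (‖poch a₁ p.1‖ * ‖poch a₂ p.1‖ * ‖poch a₃ p.2‖ * ‖poch (d + p.1) p.2‖ /
        (p.1.factorial * p.2.factorial * poch S (p.1 + p.2))) := by
  have h : Summable fun n : ℕ => (((n : ℝ) + 1) ^ 2)⁻¹ := by
    have := (summable_nat_add_iff 1).2 (Real.summable_nat_pow_inv.2 (show 1 < 2 by norm_num))
    simpa using this
  have h2 := (h.mul_of_nonneg h (fun _ => by positivity) (fun _ => by positivity)).mul_left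
    (poch ((A : ℝ) + 1) (2 * (A + 3)))
  refine Summable.of_nonneg_of_le (fun p => ?_) (fun p => ?_) h2
  · have := poch_nonneg (r := S) ((by positivity : (0 : ℝ) ≤ 3 * A + 7).trans hS) (p.1 + p.2)
    positivity
  · rw [← mul_assoc]
    exact norm_poch_product_le h₁ h₂ h₃ hd hS p.1 p.2

theorem norm_gaussCoeff_le (a b : ℂ) {c : ℂ} {r : ℝ} (hr : 0 < r) (hc : r ≤ c.re) (n : ℕ) :
    ‖gaussCoeff a b c n‖ ≤ ‖poch a n‖ * ‖poch b n‖ / (poch r n * n.factorial) := by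
  have h := poch_pos hr n
  have h0 : (0 : ℝ) < n.factorial := by exact_mod_cast n.factorial_pos
  rw [gaussCoeff, norm_div, norm_mul, norm_mul, Complex.norm_natCast]
  gcongr
  exact poch_le_norm_poch hr.le hc n

/-- The termwise difference of the two sides is `n gₙ - (n + 1) gₙ₊₁`, with `g` the coefficients for
`c`, and so telescopes to `0`. -/
theorem tsum_gaussCoeff_contiguous {a b c : ℂ} (hc : 0 < c.re)
    (hs : Summable fun n : ℕ => (n : ℂ) * gaussCoeff a b c n) (hs0 : Summable (gaussCoeff a b c))
    (hs1 : Summable (gaussCoeff a b (c + 1))) :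
    (c - a - b) * ∑' n, gaussCoeff a b c n =
      (c - a) * (c - b) / c * ∑' n, gaussCoeff a b (c + 1) n := by
  have hc0 : c ≠ 0 := by rintro rfl; simp at hc
  have h1 : ∑' n : ℕ, (n : ℂ) * gaussCoeff a b c n =
      ∑' n : ℕ, ((n + 1 : ℕ) : ℂ) * gaussCoeff a b c (n + 1) := by
    rw [hs.tsum_eq_zero_add]; simp
  have hs' := (summable_nat_add_iff 1).2 hs
  rw [← sub_eq_zero, ← tsum_mul_left, ← tsum_mul_left,
    ← (hs0.mul_left _).tsum_sub (hs1.mul_left _), ← sub_eq_zero.2 h1, ← hs.tsum_sub hs']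
  refine tsum_congr fun n => ?_
  have h3 := poch_ne_zero hc n
  have h4 := poch_ne_zero (show 0 < (c + 1).re by simp; linarith) n
  have h5 : c * poch (c + 1) n = poch c n * (c + n) := by rw [← poch_succ', poch_succ]
  have h6 : c + (n : ℂ) ≠ 0 := by
    intro h; rw [h, mul_zero] at h5; exact mul_ne_zero hc0 h4 h5
  have h7 : (n.factorial : ℂ) ≠ 0 := by exact_mod_cast n.factorial_ne_zero
  have h8 : (n : ℂ) + 1 ≠ 0 := by exact_mod_cast n.succ_ne_zero
  have h9 : gaussCoeff a b (c + 1) n = gaussCoeff a b c n * (c / (c + n)) := by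
    rw [gaussCoeff, gaussCoeff, show poch (c + 1) n = poch c n * (c + n) / c by
      rw [← h5]; field_simp]
    field_simp
  have h10 : ((n + 1 : ℕ) : ℂ) * gaussCoeff a b c (n + 1) =
      gaussCoeff a b c n * ((a + n) * (b + n) / (c + n)) := by
    rw [gaussCoeff, gaussCoeff, poch_succ, poch_succ, poch_succ, Nat.factorial_succ]
    push_cast
    field_simp
  rw [h9, h10]
  field_simp
  ring

theorem poch_succ_eq_div_GammaSeq {s : ℂ} (hs : 0 < s.re) {n : ℕ} (hn : n ≠ 0) :
    poch s (n + 1) = (n : ℂ) ^ s * n.factorial / Complex.GammaSeq s n := by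
  have hprod : ∀ m, ∏ j ∈ Finset.range m, (s + j) = poch s m := by
    intro m
    induction m with
    | zero => simp
    | succ m ih => rw [Finset.prod_range_succ, ih, poch_succ]
  have h1 := poch_ne_zero hs (n + 1)
  have h2 : (n.factorial : ℂ) ≠ 0 := by exact_mod_cast n.factorial_ne_zero
  have h3 : (n : ℂ) ^ s ≠ 0 := by
    rw [Complex.cpow_ne_zero_iff]
    left
    exact_mod_cast hn
  rw [Complex.GammaSeq, hprod]
  field_simp

/-- In Euler's limit for `Γ` the powers of `n` cancel, because `(c - a) + (c - b) = c + (c - a -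
b)`. -/
theorem tendsto_poch_ratio {a b c : ℂ} (hc : 0 < c.re) (hca : 0 < (c - a).re)
    (hcb : 0 < (c - b).re) (hcab : 0 < (c - a - b).re) :
    Tendsto (fun n => poch (c - a) n * poch (c - b) n / (poch c n * poch (c - a - b) n)) atTop
      (𝓝 (Complex.Gamma c * Complex.Gamma (c - a - b) /
        (Complex.Gamma (c - a) * Complex.Gamma (c - b)))) := by
  rw [← tendsto_add_atTop_iff_nat 1]
  have h := ((Complex.GammaSeq_tendsto_Gamma c).mul (Complex.GammaSeq_tendsto_Gamma (c - a - b))).div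
    ((Complex.GammaSeq_tendsto_Gamma (c - a)).mul (Complex.GammaSeq_tendsto_Gamma (c - b)))
    (mul_ne_zero (Complex.Gamma_ne_zero_of_re_pos hca) (Complex.Gamma_ne_zero_of_re_pos hcb))
  refine h.congr' ?_
  filter_upwards [eventually_ne_atTop 0] with n hn
  have hn' : (n : ℂ) ≠ 0 := by exact_mod_cast hn
  have h2 : (n.factorial : ℂ) ≠ 0 := by exact_mod_cast n.factorial_ne_zero
  have h3 : ∀ s : ℂ, (n : ℂ) ^ s ≠ 0 := fun s => by
    rw [Complex.cpow_ne_zero_iff]; exact Or.inl hn'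
  have h4 : (n : ℂ) ^ (c - a) * (n : ℂ) ^ (c - b) = (n : ℂ) ^ c * (n : ℂ) ^ (c - a - b) := by
    rw [← Complex.cpow_add _ _ hn', ← Complex.cpow_add _ _ hn']; ring_nf
  have h5 : ∀ {s : ℂ}, 0 < s.re → Complex.GammaSeq s n ≠ 0 := fun {s} hs h0 => by
    have := poch_succ_eq_div_GammaSeq hs hn
    rw [h0, div_zero] at this
    exact poch_ne_zero hs _ this
  have g1 := h5 hc
  have g2 := h5 hca
  have g3 := h5 hcb
  have g4 := h5 hcab
  rw [poch_succ_eq_div_GammaSeq hc hn, poch_succ_eq_div_GammaSeq hca hn,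
    poch_succ_eq_div_GammaSeq hcb hn, poch_succ_eq_div_GammaSeq hcab hn]
  have k1 := h3 c
  have k2 := h3 (c - a - b)
  simp only [Pi.div_apply]
  generalize (n : ℂ) ^ (c - a) = x1 at *
  generalize (n : ℂ) ^ (c - b) = x2 at *
  generalize (n : ℂ) ^ (c - a - b) = x3 at *
  generalize (n : ℂ) ^ c = x4 at *
  field_simp
  linear_combination -h4

/-- Gauss's summation of `₂F₁(a, b; c; 1)`. -/
theorem hasSum_gaussCoeff_one {a b c : ℂ} (hc : 0 < c.re) (hca : 0 < (c - a).re)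
    (hcb : 0 < (c - b).re) (hcab : 0 < (c - a - b).re)
    (hs : Summable fun n : ℕ => ((n : ℝ) + 1) *
      (‖poch a n‖ * ‖poch b n‖ / (poch c.re n * n.factorial))) :
    HasSum (gaussCoeff a b c) (Complex.Gamma c * Complex.Gamma (c - a - b) /
      (Complex.Gamma (c - a) * Complex.Gamma (c - b))) := by
  set g : ℕ → ℝ := fun n => ‖poch a n‖ * ‖poch b n‖ / (poch c.re n * n.factorial) with hg
  have hg0 : ∀ n, 0 ≤ g n := fun n => by
    have := poch_pos hc n
    positivity
  have hgs : Summable g := Summable.of_nonneg_of_le hg0 (fun n => by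
    have := hg0 n
    have h1 : (1 : ℝ) ≤ (n : ℝ) + 1 := by simp
    nlinarith) hs
  have hre : ∀ j : ℕ, c.re ≤ (c + j).re := fun j => by simp
  have hb : ∀ j n : ℕ, ‖gaussCoeff a b (c + j) n‖ ≤ g n := fun j n =>
    norm_gaussCoeff_le a b hc (hre j) n
  have hsj : ∀ j : ℕ, Summable (gaussCoeff a b (c + j)) := fun j =>
    Summable.of_norm_bounded hgs (hb j)
  have hsn : ∀ j : ℕ, Summable fun n : ℕ => (n : ℂ) * gaussCoeff a b (c + j) n := fun j =>
    Summable.of_norm_bounded hs fun n => by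
      rw [norm_mul, Complex.norm_natCast]
      exact mul_le_mul (by linarith) (hb j n) (norm_nonneg _) (by positivity)
  -- The contiguous relation, iterated `J` times, moves `c` to `c + J`.
  have hprod : ∀ J : ℕ, ∑' n, gaussCoeff a b c n =
      poch (c - a) J * poch (c - b) J / (poch c J * poch (c - a - b) J) *
        ∑' n, gaussCoeff a b (c + J) n := by
    intro J
    induction J with
    | zero => simp
    | succ J ih =>
      have hcJ : 0 < (c + J).re := hc.trans_le (hre J)
      have h := tsum_gaussCoeff_contiguous hcJ (hsn J) (hsj J) (by
        have := hsj (J + 1); push_cast at this; rwa [add_assoc])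
      have p1 := poch_ne_zero hc (J + 1)
      have p2 := poch_ne_zero hcab (J + 1)
      rw [poch_succ] at p1 p2
      have p3 := right_ne_zero_of_mul p1
      have p4 := right_ne_zero_of_mul p2
      have p5 := left_ne_zero_of_mul p1
      have p6 := left_ne_zero_of_mul p2
      have h' : ∑' n, gaussCoeff a b (c + J) n = (c - a + J) * (c - b + J) /
          ((c + J) * (c - a - b + J)) * ∑' n, gaussCoeff a b (c + (J + 1 : ℕ)) n := by
        push_cast
        rw [← add_assoc]
        generalize ∑' n, gaussCoeff a b (c + J + 1) n = X at *
        field_simp at h ⊢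
        linear_combination h
      rw [ih, h', poch_succ, poch_succ, poch_succ, poch_succ]
      field_simp
  -- As `J → ∞` only the term `n = 0`, equal to `1`, survives; `g` dominates uniformly in `J`.
  have hlim : Tendsto (fun J : ℕ => ∑' n, gaussCoeff a b (c + J) n) atTop (𝓝 1) := by
    have h1 : (1 : ℂ) = ∑' n : ℕ, if n = 0 then 1 else 0 := by simp
    rw [h1]
    refine tendsto_tsum_of_dominated_convergence hgs (fun n => ?_)
      (Eventually.of_forall fun J n => hb J n)
    rcases n with _ | n
    · simp [gaussCoeff]
    · simp only [Nat.add_eq_zero_iff, one_ne_zero, and_false, if_false]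
      have hz : Tendsto (fun J : ℕ => (‖poch a (n + 1)‖ * ‖poch b (n + 1)‖ / poch c.re n) / (J : ℝ))
          atTop (𝓝 0) := tendsto_const_nhds.div_atTop tendsto_natCast_atTop_atTop
      refine squeeze_zero_norm' ?_ hz
      filter_upwards [eventually_gt_atTop 0] with J hJ
      have hJ' : (0 : ℝ) < J := by exact_mod_cast hJ
      have hp := poch_pos hc n
      have hden : poch c.re n * J ≤ ‖poch (c + J) (n + 1) * ((n + 1).factorial : ℂ)‖ := by
        rw [norm_mul, Complex.norm_natCast]
        have q1 : (1 : ℝ) ≤ (n + 1).factorial := by exact_mod_cast Nat.factorial_pos _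
        have q2 : poch c.re n * J ≤ ‖poch (c + J) (n + 1)‖ := by
          rw [poch_succ', norm_mul, mul_comm]
          refine mul_le_mul ?_ (poch_le_norm_poch hc.le (by simp; linarith) n) hp.le (norm_nonneg _)
          refine le_trans ?_ (Complex.re_le_norm _)
          simp [hc.le]
        nlinarith [norm_nonneg (poch (c + J) (n + 1))]
      rw [gaussCoeff, norm_div, norm_mul, div_div]
      gcongr
  have hfin : ∑' n, gaussCoeff a b c n = Complex.Gamma c * Complex.Gamma (c - a - b) /
      (Complex.Gamma (c - a) * Complex.Gamma (c - b)) := by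
    refine tendsto_nhds_unique (tendsto_const_nhds (f := (atTop : Filter ℕ))) ?_
    have := (tendsto_poch_ratio hc hca hcb hcab).mul hlim
    rw [mul_one] at this
    exact this.congr fun J => (hprod J).symm
  rw [← hfin]
  have := hsj 0
  simp only [Nat.cast_zero, add_zero] at this
  exact this.hasSum

end GaussSum

/-! ### The Mellin transform of the kernel for large `Re s`. -/

section Mellin

open MeasureTheory

theorem integrable_and_hasSum_integral {α ι : Type*} [Countable ι] [MeasurableSpace α]
    {ν : Measure α} {F : ι → α → ℂ} {f : α → ℂ} (hF : ∀ i, Integrable (F i) ν)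
    (hs : Summable fun i => ∫ a, ‖F i a‖ ∂ν) (hf : ∀ᵐ a ∂ν, HasSum (fun i => F i a) (f a)) :
    Integrable f ν ∧ HasSum (fun i => ∫ a, F i a ∂ν) (∫ a, f a ∂ν) := by
  have hlint : ∑' i, ∫⁻ a, ‖F i a‖ₑ ∂ν ≠ ⊤ := by
    have (i : ι) : ∫⁻ a, ‖F i a‖ₑ ∂ν = ENNReal.ofReal (∫ a, ‖F i a‖ ∂ν) :=
      (ofReal_integral_norm_eq_lintegral_enorm (hF i)).symm
    rw [funext this]
    exact hs.tsum_ofReal_ne_top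
  have hmeas : AEStronglyMeasurable f ν := by
    refine aestronglyMeasurable_of_tendsto_ae (u := (atTop : Filter (Finset ι)))
      (f := fun S a => ∑ i ∈ S, F i a) (fun S => ?_) hf
    exact Finset.aestronglyMeasurable_fun_sum S fun i _ => (hF i).1
  refine ⟨⟨hmeas, ?_⟩, ?_⟩
  · refine lt_of_le_of_lt ?_ hlint.lt_top
    rw [← lintegral_tsum fun i => (hF i).1.enorm]
    refine lintegral_mono_ae ?_
    filter_upwards [hf] with a ha
    rw [← ha.tsum_eq]
    exact enorm_tsum_le_tsum_enorm
  · have h := hasSum_integral_of_summable_integral_norm hF hs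
    rwa [integral_congr_ae (g := f)] at h
    filter_upwards [hf] with a ha using ha.tsum_eq

theorem integral_Ioo_beta {s G : ℂ} (hs : 0 < s.re) (hG : 0 < G.re) (N : ℕ) :
    IntegrableOn (fun u : ℝ => (u : ℂ) ^ (s - 1) * (((1 - u : ℝ) : ℂ) ^ (G - 1) *
        ((1 - u : ℝ) : ℂ) ^ N)) (Set.Ioo 0 1) ∧
      ∫ u in Set.Ioo (0 : ℝ) 1, (u : ℂ) ^ (s - 1) * (((1 - u : ℝ) : ℂ) ^ (G - 1) *
        ((1 - u : ℝ) : ℂ) ^ N) =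
      Complex.Gamma s * Complex.Gamma G / Complex.Gamma (s + G) * (poch G N / poch (s + G) N) := by
  have hGN : 0 < (G + N).re := by simp; positivity
  have hsG : 0 < (s + G).re := by simp; positivity
  have e : Set.EqOn (fun u : ℝ => (u : ℂ) ^ (s - 1) * (((1 - u : ℝ) : ℂ) ^ (G - 1) *
      ((1 - u : ℝ) : ℂ) ^ N)) (fun u : ℝ => (u : ℂ) ^ (s - 1) * (1 - (u : ℂ)) ^ (G + N - 1))
      (Set.Ioo 0 1) := by
    intro u hu
    have h1 : ((1 - u : ℝ) : ℂ) ≠ 0 := by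
      have : (1 - u : ℝ) ≠ 0 := by linarith [hu.2]
      exact_mod_cast this
    simp only
    rw [← Complex.cpow_natCast, ← Complex.cpow_add _ _ h1]
    push_cast
    ring_nf
  have hint := Complex.betaIntegral_convergent hs hGN
  rw [intervalIntegrable_iff_integrableOn_Ioo_of_le zero_le_one] at hint
  refine ⟨hint.congr_fun e.symm measurableSet_Ioo, ?_⟩
  rw [setIntegral_congr_fun measurableSet_Ioo e, ← integral_Ioc_eq_integral_Ioo,
    ← intervalIntegral.integral_of_le zero_le_one]
  have h := Complex.Gamma_mul_Gamma_eq_betaIntegral hs hGN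
  rw [Complex.betaIntegral, ← add_assoc, Gamma_add_nat_eq_poch_mul hG,
    Gamma_add_nat_eq_poch_mul hsG] at h
  have h1 := poch_ne_zero hsG N
  have h2 := Complex.Gamma_ne_zero_of_re_pos hsG
  field_simp
  linear_combination -h

/-- The norm of the integrand is the same integrand with `s` and `G` replaced by their real parts.
-/
theorem integral_Ioo_norm_beta {s G : ℂ} (hs : 0 < s.re) (hG : 0 < G.re) (N : ℕ) :
    ∫ u in Set.Ioo (0 : ℝ) 1, ‖(u : ℂ) ^ (s - 1) * (((1 - u : ℝ) : ℂ) ^ (G - 1) *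
        ((1 - u : ℝ) : ℂ) ^ N)‖ =
      ‖Complex.Gamma s.re * Complex.Gamma G.re / Complex.Gamma (s.re + G.re : ℂ)‖ *
        (poch G.re N / poch (s.re + G.re) N) := by
  have h := (integral_Ioo_beta (s := (s.re : ℂ)) (G := (G.re : ℂ)) hs hG N).2
  have e : ∀ u ∈ Set.Ioo (0 : ℝ) 1, (u : ℂ) ^ ((s.re : ℂ) - 1) * (((1 - u : ℝ) : ℂ) ^
      ((G.re : ℂ) - 1) * ((1 - u : ℝ) : ℂ) ^ N) =
      ((‖(u : ℂ) ^ (s - 1) * (((1 - u : ℝ) : ℂ) ^ (G - 1) * ((1 - u : ℝ) : ℂ) ^ N)‖ : ℝ) : ℂ) := by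
    intro u hu
    have h1 : 0 < 1 - u := by linarith [hu.2]
    rw [norm_mul, norm_mul, norm_pow, Complex.norm_cpow_eq_rpow_re_of_pos hu.1,
      Complex.norm_cpow_eq_rpow_re_of_pos h1, Complex.norm_real, Real.norm_of_nonneg h1.le]
    rw [Complex.ofReal_mul, Complex.ofReal_mul, Complex.ofReal_cpow hu.1.le,
      Complex.ofReal_cpow h1.le]
    simp
  rw [setIntegral_congr_fun measurableSet_Ioo e, integral_complex_ofReal] at h
  have h2 := congrArg norm h
  rw [Complex.norm_real, Real.norm_of_nonneg (integral_nonneg fun _ => norm_nonneg _)] at h2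
  rw [h2, norm_mul, norm_div (poch _ _), norm_poch_ofReal hG.le, ← Complex.ofReal_add,
    norm_poch_ofReal (by positivity)]

/-- The coefficients of the expansion of `u ^ (-L') F₃(L, L', X, X'; G; 1 - u, 1 - 1 / u)` in powers
of `1 - u`. -/
noncomputable def appellCoeff (L L' X X' G : ℂ) (p : ℕ × ℕ) : ℂ :=
  poch L p.1 * poch X p.1 * poch L' p.2 * poch (G - X' + p.1) p.2 /
    (p.1.factorial * p.2.factorial * poch G (p.1 + p.2))

/-- The free parameter `S` isolates the ratio `(S)_N / (Re G)_N`, `N = p.1 + p.2`, from a summable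
factor. Pointwise the ratio is absorbed by `v ^ N`; under the integral, with `S = Re (s + G)`, it
cancels against the beta moments. -/
theorem norm_appellCoeff_le (L L' X X' : ℂ) {G : ℂ} (hG : 0 < G.re) {S : ℝ} (hS : 0 < S)
    (p : ℕ × ℕ) : ‖appellCoeff L L' X X' G p‖ ≤ poch S (p.1 + p.2) / poch G.re (p.1 + p.2) *
      (((p.1 : ℝ) + 1) * (p.2 + 1) *
      (‖poch L p.1‖ * ‖poch X p.1‖ * ‖poch L' p.2‖ * ‖poch (G - X' + p.1) p.2‖ /
        (p.1.factorial * p.2.factorial * poch S (p.1 + p.2)))) := by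
  have h1 := poch_pos hG (p.1 + p.2)
  have h2 := poch_pos hS (p.1 + p.2)
  have h3 := poch_le_norm_poch hG.le le_rfl (p.1 + p.2)
  have hm0 : (0 : ℝ) < p.1.factorial := by exact_mod_cast p.1.factorial_pos
  have hn0 : (0 : ℝ) < p.2.factorial := by exact_mod_cast p.2.factorial_pos
  have h4 : (1 : ℝ) ≤ ((p.1 : ℝ) + 1) * (p.2 + 1) := by
    have : (0 : ℝ) ≤ p.1 := by positivity
    have : (0 : ℝ) ≤ p.2 := by positivity
    nlinarith
  simp only [appellCoeff, norm_div, norm_mul, Complex.norm_natCast]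
  have hQ : 0 ≤ ‖poch L p.1‖ * ‖poch X p.1‖ * ‖poch L' p.2‖ * ‖poch (G - X' + p.1) p.2‖ := by
    positivity
  generalize ‖poch L p.1‖ * ‖poch X p.1‖ * ‖poch L' p.2‖ * ‖poch (G - X' + p.1) p.2‖ = Q at *
  calc Q / (p.1.factorial * p.2.factorial * ‖poch G (p.1 + p.2)‖)
        ≤ Q / (p.1.factorial * p.2.factorial * poch G.re (p.1 + p.2)) := by gcongr
      _ = poch S (p.1 + p.2) / poch G.re (p.1 + p.2) * (1 *
        (Q / (p.1.factorial * p.2.factorial * poch S (p.1 + p.2)))) := by field_simp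
      _ ≤ _ := by gcongr

theorem exists_nat_norm_le (L L' X Z : ℂ) :
    ∃ A : ℕ, ‖L‖ ≤ A + 1 ∧ ‖L'‖ ≤ A + 1 ∧ ‖X‖ ≤ A + 1 ∧ ‖Z‖ ≤ A + 1 := by
  obtain ⟨A, hA⟩ := exists_nat_ge (‖L‖ + ‖L'‖ + ‖X‖ + ‖Z‖)
  have := norm_nonneg L
  have := norm_nonneg L'
  have := norm_nonneg X
  have := norm_nonneg Z
  exact ⟨A, by linarith, by linarith, by linarith, by linarith⟩

theorem summable_appellCoeff_mul_pow (L L' X X' : ℂ) {G : ℂ} (hG : 0 < G.re) {v : ℝ} (h0 : 0 ≤ v)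
    (h1 : v < 1) :
    Summable fun p : ℕ × ℕ => appellCoeff L L' X X' G p * (v : ℂ) ^ (p.1 + p.2) := by
  obtain ⟨A, hL, hL', hX, hZ⟩ := exists_nat_norm_le L L' X (G - X')
  have hS : (0 : ℝ) < 3 * A + 7 := by positivity
  have hs := summable_norm_poch_product hL hX hL' hZ le_rfl
  -- With `b = 1` the factorial cancels, so the ratio times `v ^ N` is a term of this convergent
  -- series and is bounded by its sum.
  have hg := summable_norm_gaussCoeff ((3 * A + 7 : ℝ) : ℂ) 1 (c := (G.re : ℂ)) hG h0 h1
  refine Summable.of_norm_bounded (hs.mul_left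
    (∑' n, ‖gaussCoeff ((3 * A + 7 : ℝ) : ℂ) 1 G.re n‖ * v ^ n)) fun p => ?_
  have hle := hg.le_tsum (p.1 + p.2) fun j _ => by positivity
  have e : ‖gaussCoeff ((3 * A + 7 : ℝ) : ℂ) 1 G.re (p.1 + p.2)‖ =
      poch (3 * A + 7 : ℝ) (p.1 + p.2) / poch G.re (p.1 + p.2) := by
    have : ((p.1 + p.2).factorial : ℝ) ≠ 0 := by exact_mod_cast Nat.factorial_ne_zero _
    rw [gaussCoeff, norm_div, norm_mul, norm_mul, norm_poch_ofReal hS.le, norm_poch_ofReal hG.le,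
      poch_one_left, Complex.norm_natCast, mul_div_mul_right _ _ this]
  rw [e] at hle
  rw [norm_mul, norm_pow, Complex.norm_real, Real.norm_of_nonneg h0]
  refine (mul_le_mul_of_nonneg_right (norm_appellCoeff_le L L' X X' hG hS p)
    (by positivity)).trans ?_
  rw [mul_right_comm]
  refine mul_le_mul_of_nonneg_right hle ?_
  have := poch_pos hS (p.1 + p.2)
  positivity

/-- Pfaff's transformation of the inner Gauss function produces `u ^ L'`, which cancels `u ^ (-L')`
and leaves a power series in `1 - u`. -/
theorem appellF3_eq_tsum_appellCoeff (L L' X X' : ℂ) {G : ℂ} (hG : 0 < G.re) {u : ℝ} (h0 : 0 < u)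
    (h1 : u < 1) :
    HasSum (fun p : ℕ × ℕ => appellCoeff L L' X X' G p * ((1 - u : ℝ) : ℂ) ^ (p.1 + p.2))
      ((u : ℂ) ^ (-L') *
        appellF3 L L' X X' G ((1 - u : ℝ) : ℂ) ((1 - 1 / u : ℝ) : ℂ)) := by
  have hs := summable_appellCoeff_mul_pow L L' X X' hG (v := 1 - u) (by linarith) (by linarith)
  have hu : (u : ℂ) ≠ 0 := by exact_mod_cast h0.ne'
  have hu1 : (u : ℂ) ^ (-L') * (u : ℂ) ^ L' = 1 := by
    rw [← Complex.cpow_add _ _ hu]; simp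
  convert hs.hasSum using 1
  rw [hs.tsum_prod, appellF3, ← tsum_mul_left]
  refine tsum_congr fun m => ?_
  have hGm : 0 < (G + m).re := by simp; positivity
  have hv : ‖((1 - u : ℝ) : ℂ)‖ < 1 := by
    rw [Complex.norm_real, Real.norm_of_nonneg (by linarith)]; linarith
  rw [gaussF_one_sub_inv L' X' hGm h0 h1, ← (hasSum_gaussCoeff L' (G + m - X') hGm hv).tsum_eq,
    mul_left_comm, ← mul_assoc ((u : ℂ) ^ (-L')), hu1, one_mul, ← tsum_mul_left]
  refine tsum_congr fun n => ?_
  simp only [gaussCoeff, appellCoeff]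
  rw [pow_add, poch_add, show G - X' + m = G + m - X' by ring]
  simp only [poch]
  have h3 := poch_ne_zero hG m
  have h4 := poch_ne_zero hGm n
  rw [poch] at h3 h4
  have h5 : (n.factorial : ℂ) ≠ 0 := by exact_mod_cast n.factorial_ne_zero
  have h6 : (m.factorial : ℂ) ≠ 0 := by exact_mod_cast m.factorial_ne_zero
  field_simp

/-- The kernel of the Marichev–Saigo–Maeda integral at `x = 1`. -/
noncomputable def msmKernel (L L' X X' G : ℂ) (u : ℝ) : ℂ :=
  ((1 - u : ℝ) : ℂ) ^ (G - 1) * ((u : ℂ) ^ (-L') *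
    appellF3 L L' X X' G ((1 - u : ℝ) : ℂ) ((1 - 1 / u : ℝ) : ℂ))

theorem hasSum_gaussCoeff_one_of_le {A : ℕ} {L X : ℂ} (hL : ‖L‖ ≤ A + 1) (hX : ‖X‖ ≤ A + 1) {c : ℂ}
    (hc : 3 * A + 7 ≤ c.re) :
    HasSum (gaussCoeff L X c) (Complex.Gamma c * Complex.Gamma (c - L - X) /
      (Complex.Gamma (c - L) * Complex.Gamma (c - X))) := by
  have hA : (0 : ℝ) ≤ A := by positivity
  have h1 := Complex.re_le_norm L
  have h2 := Complex.re_le_norm X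
  refine hasSum_gaussCoeff_one (by linarith) (by rw [Complex.sub_re]; linarith)
    (by rw [Complex.sub_re]; linarith) (by rw [Complex.sub_re, Complex.sub_re]; linarith) ?_
  have h := summable_norm_poch_product hL hX hL hL hc
  have h' := h.comp_injective (i := fun m : ℕ => (m, 0)) fun a b hab => by simpa using hab
  refine h'.congr fun m => ?_
  simp [mul_comm]

theorem hasSum_gaussCoeff_one_shift {A : ℕ} {L' Z : ℂ} (hL' : ‖L'‖ ≤ A + 1) (hZ : ‖Z‖ ≤ A + 1)
    {c : ℂ} (hc : 3 * A + 7 ≤ c.re) (m : ℕ) :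
    HasSum (gaussCoeff L' (Z + m) (c + m)) (Complex.Gamma (c + m) * Complex.Gamma (c - L' - Z) /
      (Complex.Gamma (c - L' + m) * Complex.Gamma (c - Z))) := by
  have hA : (0 : ℝ) ≤ A := by positivity
  have hm : (0 : ℝ) ≤ m := by positivity
  have h1 := Complex.re_le_norm L'
  have h2 := Complex.re_le_norm Z
  rw [show c - L' - Z = c + m - L' - (Z + m) by ring, show c - L' + m = c + m - L' by ring,
    show c - Z = c + m - (Z + m) by ring]
  refine hasSum_gaussCoeff_one (by simp; linarith) (by simp; linarith)
    (by simp; linarith) (by simp; linarith) ?_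
  -- Row `m` of the double estimate; with `a₁ = a₂ = 1` the factors in `m` are nonzero constants
  -- that can be divided out.
  have h := summable_norm_poch_product (a₁ := 1) (a₂ := 1) (by simp) (by simp) hL' hZ hc
  refine ((h.prod_factor m).mul_left (poch c.re m / ((m + 1) * m.factorial))).congr fun n => ?_
  have hp := poch_pos (r := c.re) (by linarith) m
  have hm0 : (0 : ℝ) < m.factorial := by exact_mod_cast m.factorial_pos
  simp only [poch_add, poch_one_left, Complex.norm_natCast, Complex.add_re, Complex.natCast_re]
  field_simp

/-- After termwise beta integration, the sum over `n` is a Gauss sum with lower parameter `s + G +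
m`. Its value contains `Γ(s+G+m) / Γ(s+G-L'+m)`, which turns `(s+G)_m` into `(s+G-L')_m`; the sum
over `m` is then again a Gauss sum, with lower parameter `s + G - L'`. -/
theorem integrableOn_and_integral_msmKernel_of_le {A : ℕ} {L L' X X' G : ℂ} (hL : ‖L‖ ≤ A + 1)
    (hL' : ‖L'‖ ≤ A + 1) (hX : ‖X‖ ≤ A + 1) (hZ : ‖G - X'‖ ≤ A + 1) (hG : 0 < G.re)
    {s : ℂ} (hs0 : 0 < s.re) (hs1 : 3 * A + 7 ≤ (s + G).re) (hs2 : 3 * A + 7 ≤ (s + G - L').re) :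
    IntegrableOn (fun u : ℝ => (u : ℂ) ^ (s - 1) * msmKernel L L' X X' G u) (Set.Ioo 0 1) ∧
      ∫ u in Set.Ioo (0 : ℝ) 1, (u : ℂ) ^ (s - 1) * msmKernel L L' X X' G u =
        Complex.Gamma G * (Complex.Gamma s * Complex.Gamma (s + X' - L') *
          Complex.Gamma (s + G - L' - L - X)) /
          (Complex.Gamma (s + X') * Complex.Gamma (s + G - L' - L) *
            Complex.Gamma (s + G - L' - X)) := by
  have hA : (0 : ℝ) ≤ A := by positivity
  have hsG : 0 < (s + G).re := by linarith
  have hsGL : 0 < (s + G - L').re := by linarith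
  set F : ℕ × ℕ → ℝ → ℂ := fun p u => (u : ℂ) ^ (s - 1) * (((1 - u : ℝ) : ℂ) ^ (G - 1) *
    ((1 - u : ℝ) : ℂ) ^ (p.1 + p.2)) * appellCoeff L L' X X' G p with hF
  have hFint : ∀ p, IntegrableOn (F p) (Set.Ioo 0 1) := fun p =>
    (integral_Ioo_beta hs0 hG (p.1 + p.2)).1.mul_const _
  have hFsum : Summable fun p => ∫ u in Set.Ioo (0 : ℝ) 1, ‖F p u‖ := by
    have hs := (summable_norm_poch_product hL hX hL' hZ hs1).mul_left
      ‖Complex.Gamma s.re * Complex.Gamma G.re / Complex.Gamma (s.re + G.re : ℂ)‖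
    refine Summable.of_nonneg_of_le (fun p => integral_nonneg fun _ => norm_nonneg _)
      (fun p => ?_) hs
    simp only [hF, norm_mul _ (appellCoeff L L' X X' G p), integral_mul_const]
    rw [integral_Ioo_norm_beta hs0 hG, mul_assoc]
    refine mul_le_mul_of_nonneg_left ?_ (norm_nonneg _)
    have h1 := norm_appellCoeff_le L L' X X' hG hsG p
    have h2 := poch_pos hG (p.1 + p.2)
    have h3 := poch_pos hsG (p.1 + p.2)
    rw [Complex.add_re] at h1 h3 ⊢
    refine (mul_le_mul_of_nonneg_left h1 (by positivity)).trans (le_of_eq ?_)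
    rw [← mul_assoc, div_mul_div_cancel₀ h3.ne', div_self h2.ne', one_mul]
  have hFhas : ∀ᵐ u ∂(volume.restrict (Set.Ioo (0 : ℝ) 1)), HasSum (fun p => F p u)
      ((u : ℂ) ^ (s - 1) * msmKernel L L' X X' G u) := by
    filter_upwards [ae_restrict_mem measurableSet_Ioo] with u hu
    have h := (appellF3_eq_tsum_appellCoeff L L' X X' hG hu.1 hu.2).mul_left
      ((u : ℂ) ^ (s - 1) * ((1 - u : ℝ) : ℂ) ^ (G - 1))
    rw [msmKernel, ← mul_assoc]
    have e : (fun p => F p u) = fun p => (u : ℂ) ^ (s - 1) * ((1 - u : ℝ) : ℂ) ^ (G - 1) *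
        (appellCoeff L L' X X' G p * ((1 - u : ℝ) : ℂ) ^ (p.1 + p.2)) := by
      ext p
      simp only [hF]
      ring
    rw [e]
    exact h
  obtain ⟨hint, hsum⟩ := integrable_and_hasSum_integral hFint hFsum hFhas
  refine ⟨hint, ?_⟩
  have hGn := Complex.Gamma_ne_zero_of_re_pos hG
  have hsGn := Complex.Gamma_ne_zero_of_re_pos hsG
  have hsGLn := Complex.Gamma_ne_zero_of_re_pos hsGL
  rw [← hsum.tsum_eq, hsum.summable.tsum_prod]
  have hinner : ∀ m : ℕ, ∑' n, ∫ u in Set.Ioo (0 : ℝ) 1, F (m, n) u =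
      Complex.Gamma s * Complex.Gamma G * Complex.Gamma (s + X' - L') /
        (Complex.Gamma (s + G - L') * Complex.Gamma (s + X')) *
        gaussCoeff L X (s + G - L') m := by
    intro m
    have h := (hasSum_gaussCoeff_one_shift hL' hZ hs1 m).mul_left
      (Complex.Gamma s * Complex.Gamma G / Complex.Gamma (s + G) * (poch L m * poch X m /
        (m.factorial * poch (s + G) m)))
    have h1 := poch_ne_zero hsG m
    have h2 := poch_ne_zero hsGL m
    have h0 : (m.factorial : ℂ) ≠ 0 := by exact_mod_cast m.factorial_ne_zero
    have e : (fun n => ∫ u in Set.Ioo (0 : ℝ) 1, F (m, n) u) = fun n =>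
        Complex.Gamma s * Complex.Gamma G / Complex.Gamma (s + G) * (poch L m * poch X m /
        (m.factorial * poch (s + G) m)) * gaussCoeff L' (G - X' + m) (s + G + m) n := by
      ext n
      simp only [hF, integral_mul_const]
      rw [(integral_Ioo_beta hs0 hG (m + n)).2, appellCoeff, gaussCoeff, poch_add (s + G)]
      have h3 := poch_ne_zero hG (m + n)
      have h5 : (n.factorial : ℂ) ≠ 0 := by exact_mod_cast n.factorial_ne_zero
      have h6 : poch (s + G + m) n ≠ 0 := poch_ne_zero (by simp at hsG ⊢; positivity) n
      simp only
      field_simp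
    rw [e, h.tsum_eq, Gamma_add_nat_eq_poch_mul hsG, Gamma_add_nat_eq_poch_mul hsGL, gaussCoeff,
      show s + G - L' - (G - X') = s + X' - L' by ring, show s + G - (G - X') = s + X' by ring]
    field_simp
  rw [tsum_congr hinner, tsum_mul_left, (hasSum_gaussCoeff_one_of_le hL hX hs2).tsum_eq]
  field_simp

theorem exists_integrableOn_and_integral_msmKernel (L L' X X' : ℂ) {G : ℂ} (hG : 0 < G.re) :
    ∃ T : ℝ, ∀ s : ℂ, T ≤ s.re →
      IntegrableOn (fun u : ℝ => (u : ℂ) ^ (s - 1) * msmKernel L L' X X' G u) (Set.Ioo 0 1) ∧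
      ∫ u in Set.Ioo (0 : ℝ) 1, (u : ℂ) ^ (s - 1) * msmKernel L L' X X' G u =
        Complex.Gamma G * (Complex.Gamma s * Complex.Gamma (s + X' - L') *
          Complex.Gamma (s + G - L' - L - X)) /
          (Complex.Gamma (s + X') * Complex.Gamma (s + G - L' - L) *
            Complex.Gamma (s + G - L' - X)) := by
  obtain ⟨A, hL, hL', hX, hZ⟩ := exists_nat_norm_le L L' X (G - X')
  have hA : (0 : ℝ) ≤ A := by positivity
  -- Subtracting `Re L' ≤ A + 1` must still leave `3A + 7`.
  refine ⟨4 * A + 8, fun s hs => integrableOn_and_integral_msmKernel_of_le hL hL' hX hZ hG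
    (by linarith) (by rw [Complex.add_re]; linarith) ?_⟩
  have := Complex.re_le_norm L'
  rw [Complex.sub_re, Complex.add_re]
  linarith

end Mellin

/-! ### Analytic continuation of the Mellin transform in `s`. -/

section Continuation

open MeasureTheory

variable {g : ℝ → ℂ} {r : ℝ}

theorem aestronglyMeasurable_cpow_mul (hg : IntegrableOn (fun u : ℝ => (u : ℂ) ^ ((r : ℂ) - 1) * g u)
    (Set.Ioo 0 1)) (s : ℂ) :
    AEStronglyMeasurable (fun u : ℝ => (u : ℂ) ^ (s - 1) * g u)
      (volume.restrict (Set.Ioo 0 1)) := by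
  have hm : Measurable fun u : ℝ => (u : ℂ) ^ (s - r) :=
    Complex.measurable_ofReal.pow_const _
  refine (hm.aestronglyMeasurable.mul hg.1).congr ?_
  filter_upwards [ae_restrict_mem measurableSet_Ioo] with u hu
  have : (u : ℂ) ≠ 0 := by exact_mod_cast hu.1.ne'
  rw [Pi.mul_apply, ← mul_assoc, ← Complex.cpow_add _ _ this]
  ring_nf

theorem norm_cpow_mul_le {s : ℂ} (hs : r ≤ s.re) {u : ℝ} (hu : u ∈ Set.Ioo (0 : ℝ) 1) :
    ‖(u : ℂ) ^ (s - 1) * g u‖ ≤ ‖(u : ℂ) ^ ((r : ℂ) - 1) * g u‖ := by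
  rw [norm_mul, norm_mul, Complex.norm_cpow_eq_rpow_re_of_pos hu.1,
    Complex.norm_cpow_eq_rpow_re_of_pos hu.1]
  refine mul_le_mul_of_nonneg_right ?_ (norm_nonneg _)
  refine Real.rpow_le_rpow_of_exponent_ge hu.1 hu.2.le ?_
  simpa using hs

theorem integrableOn_cpow_mul (hg : IntegrableOn (fun u : ℝ => (u : ℂ) ^ ((r : ℂ) - 1) * g u)
    (Set.Ioo 0 1)) {s : ℂ} (hs : r ≤ s.re) :
    IntegrableOn (fun u : ℝ => (u : ℂ) ^ (s - 1) * g u) (Set.Ioo 0 1) := by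
  refine Integrable.mono hg (aestronglyMeasurable_cpow_mul hg s) ?_
  filter_upwards [ae_restrict_mem measurableSet_Ioo] with u hu using norm_cpow_mul_le hs hu

theorem integral_norm_cpow_mul_le
    (hg : IntegrableOn (fun u : ℝ => (u : ℂ) ^ ((r : ℂ) - 1) * g u) (Set.Ioo 0 1))
    {s : ℂ} (hs : r ≤ s.re) :
    ∫ u in Set.Ioo (0 : ℝ) 1, ‖(u : ℂ) ^ (s - 1) * g u‖ ≤
      ∫ u in Set.Ioo (0 : ℝ) 1, ‖(u : ℂ) ^ ((r : ℂ) - 1) * g u‖ :=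
  setIntegral_mono_on (integrableOn_cpow_mul hg hs).norm hg.norm measurableSet_Ioo
    fun _ hu => norm_cpow_mul_le hs hu

theorem continuousOn_integral_cpow_mul
    (hg : IntegrableOn (fun u : ℝ => (u : ℂ) ^ ((r : ℂ) - 1) * g u) (Set.Ioo 0 1)) :
    ContinuousOn (fun s : ℂ => ∫ u in Set.Ioo (0 : ℝ) 1, (u : ℂ) ^ (s - 1) * g u)
      {s | r ≤ s.re} := by
  refine continuousOn_of_dominated (fun s _ => aestronglyMeasurable_cpow_mul hg s)
    (fun s hs => ?_) hg.norm ?_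
  · filter_upwards [ae_restrict_mem measurableSet_Ioo] with u hu using norm_cpow_mul_le hs hu
  · filter_upwards [ae_restrict_mem measurableSet_Ioo] with u hu
    have : (u : ℂ) ≠ 0 := by exact_mod_cast hu.1.ne'
    refine ContinuousOn.mul (Continuous.continuousOn ?_) continuousOn_const
    exact Continuous.const_cpow (by fun_prop) (Or.inl this)

theorem differentiableOn_integral_cpow_mul
    (hg : IntegrableOn (fun u : ℝ => (u : ℂ) ^ ((r : ℂ) - 1) * g u) (Set.Ioo 0 1)) :
    DifferentiableOn ℂ (fun s : ℂ => ∫ u in Set.Ioo (0 : ℝ) 1, (u : ℂ) ^ (s - 1) * g u)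
      {s | r < s.re} := by
  intro s₀ hs₀
  have hs₀ : r < s₀.re := hs₀
  -- Half the distance to the edge: the spare factor `u ^ ε` pays for the `log u` of the derivative,
  -- since `|log u| u ^ ε ≤ 1 / ε`.
  set ε := (s₀.re - r) / 2 with hε
  have hε0 : 0 < ε := by rw [hε]; linarith
  have hball : ∀ s ∈ Metric.ball s₀ ε, r + ε ≤ s.re := by
    intro s hs
    have h1 : ‖s - s₀‖ < ε := by simpa [dist_eq_norm] using hs
    have h2 := (abs_le.1 ((Complex.abs_re_le_norm (s - s₀)))).1
    rw [Complex.sub_re] at h2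
    linarith
  refine ((hasDerivAt_integral_of_dominated_loc_of_deriv_le (μ := volume.restrict (Set.Ioo (0 : ℝ) 1))
    (F := fun (s : ℂ) (u : ℝ) => (u : ℂ) ^ (s - 1) * g u)
    (F' := fun (s : ℂ) (u : ℝ) => Complex.log u * ((u : ℂ) ^ (s - 1) * g u))
    (bound := fun u => 1 / ε * ‖(u : ℂ) ^ ((r : ℂ) - 1) * g u‖)
    (Metric.ball_mem_nhds s₀ hε0) ?_ ?_ ?_ ?_ ?_ ?_).2.differentiableAt).differentiableWithinAt
  · exact Eventually.of_forall fun s => aestronglyMeasurable_cpow_mul hg s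
  · exact integrableOn_cpow_mul hg hs₀.le
  · exact (Complex.measurable_log.comp Complex.measurable_ofReal).aestronglyMeasurable.mul
      (aestronglyMeasurable_cpow_mul hg s₀)
  · filter_upwards [ae_restrict_mem measurableSet_Ioo] with u hu s hs
    have h1 := norm_cpow_mul_le (g := g) (r := r) (s := s - ε)
      (by simp; linarith [hball s hs]) hu
    have hu0 : (u : ℂ) ≠ 0 := by exact_mod_cast hu.1.ne'
    have e : (u : ℂ) ^ (s - 1) = (u : ℂ) ^ (ε : ℂ) * (u : ℂ) ^ (s - ε - 1) := by
      rw [← Complex.cpow_add _ _ hu0]; ring_nf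
    rw [e, mul_assoc, ← mul_assoc, norm_mul]
    refine mul_le_mul ?_ h1 (norm_nonneg _) (by positivity)
    rw [norm_mul, Complex.norm_cpow_eq_rpow_re_of_pos hu.1, ← Complex.ofReal_log hu.1.le,
      Complex.norm_real, Complex.ofReal_re, Real.norm_eq_abs]
    have := (Real.abs_log_mul_self_rpow_lt u ε hu.1 hu.2.le hε0).le
    rwa [abs_mul, abs_of_nonneg (Real.rpow_nonneg hu.1.le ε)] at this
  · exact hg.norm.const_mul _
  · filter_upwards [ae_restrict_mem measurableSet_Ioo] with u hu s hs
    have hu0 : (u : ℂ) ≠ 0 := by exact_mod_cast hu.1.ne'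
    have h := (((hasDerivAt_id s).sub_const 1).const_cpow (c := (u : ℂ)) (Or.inl hu0)).mul_const
      (g u)
    refine h.congr_deriv ?_
    simp only [id]
    ring

/-- Written with reciprocal Gammas, both sides have no poles, so the identity theorem applies on `Re
s > r` and continuity adds the line `Re s = r`. That line is needed: the lowest power in the
application lies on it. -/
theorem integral_msmKernel_mul (L L' X X' : ℂ) {G : ℂ} (hG : 0 < G.re)
    (hr : IntegrableOn (fun u : ℝ => (u : ℂ) ^ ((r : ℂ) - 1) * msmKernel L L' X X' G u)
      (Set.Ioo 0 1)) {s : ℂ} (hs : r ≤ s.re) :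
    (∫ u in Set.Ioo (0 : ℝ) 1, (u : ℂ) ^ (s - 1) * msmKernel L L' X X' G u) *
        ((Complex.Gamma s)⁻¹ * (Complex.Gamma (s + X' - L'))⁻¹ *
          (Complex.Gamma (s + G - L' - L - X))⁻¹) =
      Complex.Gamma G * ((Complex.Gamma (s + X'))⁻¹ * (Complex.Gamma (s + G - L' - L))⁻¹ *
        (Complex.Gamma (s + G - L' - X))⁻¹) := by
  obtain ⟨T, hT⟩ := exists_integrableOn_and_integral_msmKernel L L' X X' hG
  have hd : ∀ {f : ℂ → ℂ}, Differentiable ℂ f → Differentiable ℂ fun s : ℂ =>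
      (Complex.Gamma (f s))⁻¹ := fun hf => Complex.differentiable_one_div_Gamma.comp hf
  have hd1 : Differentiable ℂ fun s : ℂ => (Complex.Gamma s)⁻¹ * (Complex.Gamma (s + X' - L'))⁻¹ *
      (Complex.Gamma (s + G - L' - L - X))⁻¹ :=
    ((hd differentiable_id).mul (hd (f := fun s => s + X' - L') (by fun_prop))).mul
      (hd (f := fun s => s + G - L' - L - X) (by fun_prop))
  have hd2 : Differentiable ℂ fun s : ℂ => Complex.Gamma G * ((Complex.Gamma (s + X'))⁻¹ *
      (Complex.Gamma (s + G - L' - L))⁻¹ * (Complex.Gamma (s + G - L' - X))⁻¹) :=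
    (((hd (f := fun s => s + X') (by fun_prop)).mul
      (hd (f := fun s => s + G - L' - L) (by fun_prop))).mul
      (hd (f := fun s => s + G - L' - X) (by fun_prop))).const_mul _
  have hopen : IsOpen {s : ℂ | r < s.re} := isOpen_lt continuous_const Complex.continuous_re
  have hEq : Set.EqOn (fun s : ℂ =>
      (∫ u in Set.Ioo (0 : ℝ) 1, (u : ℂ) ^ (s - 1) * msmKernel L L' X X' G u) *
        ((Complex.Gamma s)⁻¹ * (Complex.Gamma (s + X' - L'))⁻¹ *
          (Complex.Gamma (s + G - L' - L - X))⁻¹)) (fun s => Complex.Gamma G *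
      ((Complex.Gamma (s + X'))⁻¹ * (Complex.Gamma (s + G - L' - L))⁻¹ *
        (Complex.Gamma (s + G - L' - X))⁻¹)) {s : ℂ | r < s.re} := by
    have ha1 := ((differentiableOn_integral_cpow_mul hr).mul hd1.differentiableOn).analyticOnNhd
      hopen
    have ha2 := (hd2.differentiableOn (s := {s : ℂ | r < s.re})).analyticOnNhd hopen
    set R : ℝ := |r| + |T| + ‖X'‖ + ‖L'‖ + ‖L‖ + ‖X‖ + 1 with hR
    refine ha1.eqOn_of_preconnected_of_eventuallyEq ha2 (convex_halfSpace_re_gt r).isPreconnected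
      (z₀ := ((R + 1 : ℝ) : ℂ)) ?_ ?_
    · simp only [Set.mem_ofPred_eq, Complex.ofReal_re, hR]
      linarith [le_abs_self r, abs_nonneg T, norm_nonneg X', norm_nonneg L', norm_nonneg L,
        norm_nonneg X]
    · have hn : {s : ℂ | R < s.re} ∈ 𝓝 ((R + 1 : ℝ) : ℂ) :=
        (isOpen_lt continuous_const Complex.continuous_re).mem_nhds (by simp)
      filter_upwards [hn] with s hs
      have hs : R < s.re := hs
      have k1 := abs_nonneg r
      have k2 := le_abs_self T
      have k2' := abs_nonneg T
      have k3 := (abs_le.1 (Complex.abs_re_le_norm X')).1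
      have k4 := Complex.re_le_norm L'
      have k5 := Complex.re_le_norm L
      have k6 := Complex.re_le_norm X
      have k7 := norm_nonneg X'
      have k8 := norm_nonneg L'
      have k9 := norm_nonneg L
      have k10 := norm_nonneg X
      have g1 : Complex.Gamma s ≠ 0 := Complex.Gamma_ne_zero_of_re_pos (by linarith)
      have g2 : Complex.Gamma (s + X' - L') ≠ 0 :=
        Complex.Gamma_ne_zero_of_re_pos (by simp only [Complex.add_re, Complex.sub_re]; linarith)
      have g3 : Complex.Gamma (s + G - L' - L - X) ≠ 0 :=
        Complex.Gamma_ne_zero_of_re_pos (by simp only [Complex.add_re, Complex.sub_re]; linarith)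
      change (∫ u in Set.Ioo (0 : ℝ) 1, (u : ℂ) ^ (s - 1) * msmKernel L L' X X' G u) *
        (_ * _ * _) = _
      rw [(hT s (by linarith)).2]
      simp only [div_eq_mul_inv, mul_inv]
      field_simp
  have hcl : {s : ℂ | r ≤ s.re} ⊆ closure {s : ℂ | r < s.re} := by
    rw [Complex.closure_setOfPred_lt_re]
  exact hEq.of_subset_closure ((continuousOn_integral_cpow_mul hr).mul hd1.continuous.continuousOn)
    hd2.continuous.continuousOn 
    (fun s hs => (show r < s.re from hs).le) hcl hs

end Continuation

/-! ### Decay of `1 / Γ` and coefficients of entire functions. -/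

section Growth

/-- Shifting `s` left by `j = ⌊Re s⌋₊ - 1` lands in a fixed compact segment, where `1 / Γ` is
bounded. The functional equation contributes `(s - j)_j`, of norm at least `j!` because `Re (s - j)
≥ 1` when `j > 0`. -/
theorem exists_norm_inv_Gamma_mul_factorial_le (m t : ℝ) : ∃ C : ℝ, 0 ≤ C ∧ ∀ s : ℂ, m ≤ s.re →
    s.im = t → ‖(Complex.Gamma s)⁻¹‖ * (⌊s.re⌋₊ - 1).factorial ≤ C := by
  have hK : IsCompact (Set.Icc (min m 1) 2 ×ℂ {t}) := isCompact_Icc.reProdIm isCompact_singleton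
  obtain ⟨C, hC⟩ := hK.exists_bound_of_continuousOn
    Complex.differentiable_one_div_Gamma.continuous.continuousOn
  refine ⟨max C 0, le_max_right _ _, fun s hs ht => le_trans ?_ (le_max_left _ _)⟩
  set j := ⌊s.re⌋₊ - 1 with hj
  have h1 := Gamma_inv_eq_poch_mul (s - j) j
  rw [sub_add_cancel] at h1
  have him : (s - j).im = t := by simp [ht]
  have hre : (s - j).re = s.re - j := by simp
  have hlt := Nat.lt_floor_add_one s.re
  have hmem : s - j ∈ Set.Icc (min m 1) 2 ×ℂ {t} ∧ (j.factorial : ℝ) ≤ ‖poch (s - j) j‖ := by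
    rw [Complex.mem_reProdIm, him, hre]
    rcases Nat.eq_zero_or_pos j with h0 | h0
    · have h2 : ⌊s.re⌋₊ ≤ 1 := by omega
      have h2' : (⌊s.re⌋₊ : ℝ) ≤ 1 := by exact_mod_cast h2
      rw [h0]
      simp only [Nat.cast_zero, sub_zero, Nat.factorial_zero, Nat.cast_one, poch_zero, norm_one,
        le_refl, and_true, Set.mem_Icc, Set.mem_singleton_iff]
      exact ⟨(min_le_left _ _).trans hs, by linarith⟩
    · have h2 : ⌊s.re⌋₊ = j + 1 := by omega
      have h3 : (⌊s.re⌋₊ : ℝ) ≤ s.re := Nat.floor_le (by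
        by_contra hneg
        rw [Nat.floor_of_nonpos (by linarith)] at h2
        omega)
      rw [h2] at h3 hlt
      push_cast at h3 hlt
      refine ⟨⟨⟨(min_le_right _ _).trans (by linarith), by linarith⟩, rfl⟩, ?_⟩
      rw [← poch_one_left]
      exact poch_le_norm_poch zero_le_one (by rw [hre]; linarith) j
  have h2 := hC _ hmem.1
  rw [h1, norm_mul] at h2
  refine le_trans ?_ h2
  rw [mul_comm]
  exact mul_le_mul_of_nonneg_right hmem.2 (norm_nonneg _)

theorem exists_norm_inv_Gamma_mul_pow_le {α : ℝ} (hα : 0 < α) (μ : ℂ) (R : ℝ) (hR : 1 ≤ R) :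
    ∃ C : ℝ, ∀ k : ℕ, ‖(Complex.Gamma (α * k + μ))⁻¹‖ * R ^ k ≤ C := by
  obtain ⟨C, hC0, hC⟩ := exists_norm_inv_Gamma_mul_factorial_le μ.re μ.im
  obtain ⟨M, hM⟩ := exists_nat_ge (2 - μ.re)
  obtain ⟨P, hP⟩ := exists_nat_ge (1 / α)
  refine ⟨C * Real.exp (R ^ P) * (R ^ P) ^ M, fun k => ?_⟩
  have hre : (α * k + μ : ℂ).re = α * k + μ.re := by simp
  have him : (α * k + μ : ℂ).im = μ.im := by simp
  have h1 := hC (α * k + μ) (by rw [hre]; nlinarith [mul_nonneg hα.le (Nat.cast_nonneg (α := ℝ) k)])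
    him
  rw [hre] at h1
  set j := ⌊α * k + μ.re⌋₊ - 1 with hj
  have hlt := Nat.lt_floor_add_one (α * k + μ.re)
  have hj1 : (⌊α * k + μ.re⌋₊ : ℝ) ≤ j + 1 := by
    have : ⌊α * k + μ.re⌋₊ ≤ j + 1 := by omega
    exact_mod_cast this
  -- The index `k` is at most linear in `j`, so `R ^ k` is at most geometric in `j` and the
  -- factorial wins.
  have hk : k ≤ P * (j + M) := by
    have h2 : α * k ≤ j + M := by linarith
    have h3 : (k : ℝ) ≤ P * (j + M) := by
      calc (k : ℝ) = 1 / α * (α * k) := by field_simp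
        _ ≤ P * (j + M) := by gcongr
    exact_mod_cast h3
  have h4 : R ^ k ≤ (R ^ P) ^ j * (R ^ P) ^ M := by
    rw [← pow_add, ← pow_mul]
    exact pow_le_pow_right₀ hR hk
  have h5 := Real.pow_div_factorial_le_exp (R ^ P) (by positivity) j
  have hf : (0 : ℝ) < j.factorial := by exact_mod_cast j.factorial_pos
  rw [div_le_iff₀ hf] at h5
  calc _ ≤ ‖(Complex.Gamma (α * k + μ))⁻¹‖ * ((R ^ P) ^ j * (R ^ P) ^ M) := by gcongr
    _ ≤ ‖(Complex.Gamma (α * k + μ))⁻¹‖ * (Real.exp (R ^ P) * j.factorial * (R ^ P) ^ M) := by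
      gcongr
    _ = (‖(Complex.Gamma (α * k + μ))⁻¹‖ * j.factorial) * (Real.exp (R ^ P) * (R ^ P) ^ M) := by
      ring
    _ ≤ C * (Real.exp (R ^ P) * (R ^ P) ^ M) := by gcongr
    _ = _ := by ring

theorem exists_norm_inv_Gamma_nat_mul_le (a : ℕ) (β : ℂ) :
    ∃ C : ℝ, ∀ k : ℕ, ‖(Complex.Gamma (a * k + β))⁻¹‖ ≤ C := by
  rcases Nat.eq_zero_or_pos a with rfl | ha
  · exact ⟨‖(Complex.Gamma β)⁻¹‖, fun k => by simp⟩
  · obtain ⟨C, hC⟩ := exists_norm_inv_Gamma_mul_pow_le (α := a) (by exact_mod_cast ha) β 1 le_rfl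
    exact ⟨C, fun k => by simpa using hC k⟩

/-- A sequence of coefficients of an entire function. -/
def EntireCoeff (e : ℕ → ℂ) : Prop := ∀ R : ℝ, 0 ≤ R → Summable fun k => ‖e k‖ * R ^ k

theorem EntireCoeff.of_norm_le {e e' : ℕ → ℂ} (h : EntireCoeff e) {B Q : ℝ} (hQ : 0 ≤ Q)
    (hle : ∀ k, ‖e' k‖ ≤ B * Q ^ k * ‖e k‖) : EntireCoeff e' := by
  intro R hR
  refine Summable.of_nonneg_of_le (fun k => by positivity) (fun k => ?_)
    ((h (Q * R) (by positivity)).mul_left B)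
  calc _ ≤ (B * Q ^ k * ‖e k‖) * R ^ k := by gcongr; exact hle k
    _ = _ := by rw [mul_pow]; ring

theorem EntireCoeff.summable {e : ℕ → ℂ} (h : EntireCoeff e) (z : ℂ) :
    Summable fun k => e k * z ^ k := by
  refine Summable.of_norm ?_
  simpa using h ‖z‖ (norm_nonneg z)

theorem entireCoeff_struve (a : ℕ) {α : ℝ} (hα : 0 < α) (μ β c : ℂ) :
    EntireCoeff fun k => (-c) ^ k * ((Complex.Gamma (α * k + μ))⁻¹ *
      (Complex.Gamma (a * k + β))⁻¹) := by
  intro R hR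
  -- The factor `2` leaves a geometric series of ratio `1/2`; the `+ 1` makes the base at least `1`.
  obtain ⟨C₁, h₁⟩ := exists_norm_inv_Gamma_mul_pow_le hα μ (2 * (‖c‖ * R) + 1)
    (by have := norm_nonneg c; nlinarith [mul_nonneg this hR])
  obtain ⟨C₂, h₂⟩ := exists_norm_inv_Gamma_nat_mul_le a β
  have hC₂ : 0 ≤ C₂ := (norm_nonneg _).trans (h₂ 0)
  refine Summable.of_nonneg_of_le (fun k => by positivity) (fun k => ?_)
    (summable_geometric_two.mul_left (C₁ * C₂))
  have h3 : (2 * (‖c‖ * R)) ^ k ≤ (2 * (‖c‖ * R) + 1) ^ k :=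
    pow_le_pow_left₀ (by positivity) (by linarith) k
  have h4 : ‖(Complex.Gamma (α * k + μ))⁻¹‖ * (2 * (‖c‖ * R)) ^ k ≤ C₁ :=
    (mul_le_mul_of_nonneg_left h3 (norm_nonneg _)).trans (h₁ k)
  rw [norm_mul, norm_mul, norm_pow, norm_neg]
  have h2 : (1 / 2 : ℝ) ^ k * 2 ^ k = 1 := by rw [← mul_pow]; norm_num
  calc ‖c‖ ^ k * (‖(Complex.Gamma (α * k + μ))⁻¹‖ * ‖(Complex.Gamma (a * k + β))⁻¹‖) * R ^ k
      = (‖(Complex.Gamma (α * k + μ))⁻¹‖ * (2 * (‖c‖ * R)) ^ k) *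
        ‖(Complex.Gamma (a * k + β))⁻¹‖ * (1 / 2) ^ k := by
        rw [mul_pow 2, mul_pow]
        linear_combination (-‖c‖ ^ k * (‖(Complex.Gamma (α * k + μ))⁻¹‖ *
          ‖(Complex.Gamma (a * k + β))⁻¹‖) * R ^ k) * h2
    _ ≤ C₁ * C₂ * (1 / 2) ^ k := by
        have := h₂ k
        have h0 : 0 ≤ ‖(Complex.Gamma (α * k + μ))⁻¹‖ * (2 * (‖c‖ * R)) ^ k := by positivity
        have hC₁ : 0 ≤ C₁ := h0.trans h4
        gcongr

end Growth

/-! ### Derivatives of a complex power times an entire series. -/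

section Derivative

theorem EntireCoeff.hasDerivAt {e : ℕ → ℂ} (h : EntireCoeff e) (w : ℂ) :
    HasDerivAt (fun w => ∑' k, e k * w ^ k) (∑' k : ℕ, e k * (k * w ^ (k - 1))) w := by
  set R := ‖w‖ + 1 with hR
  have hR1 : 1 ≤ R := by rw [hR]; linarith [norm_nonneg w]
  -- The radius `2 R` absorbs the factor `k ≤ 2 ^ k` from differentiation.
  refine hasDerivAt_tsum_of_isPreconnected (h (2 * R) (by positivity))
    (Metric.isOpen_ball (x := (0 : ℂ)) (ε := R)) (convex_ball _ _).isPreconnected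
    (fun k z _ => (hasDerivAt_pow k z).const_mul (e k)) (fun k z hz => ?_)
    (Metric.mem_ball_self (by positivity)) (h.summable 0) (by simp [hR])
  have hz : ‖z‖ ≤ R := by simpa using (Metric.mem_ball.1 hz).le
  rw [norm_mul, norm_mul, Complex.norm_natCast, norm_pow, mul_pow]
  have h1 : (k : ℝ) ≤ 2 ^ k := by exact_mod_cast k.lt_two_pow_self.le
  have h2 : ‖z‖ ^ (k - 1) ≤ R ^ k :=
    (pow_le_pow_left₀ (norm_nonneg z) hz _).trans (pow_le_pow_right₀ hR1 (Nat.sub_le _ _))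
  gcongr

theorem EntireCoeff.linear_mul {e : ℕ → ℂ} (h : EntireCoeff e) (ν : ℂ) :
    EntireCoeff fun k => (ν + 2 * k) * e k := by
  refine h.of_norm_le (B := ‖ν‖ + 2) (Q := 2) (by norm_num) fun k => ?_
  rw [norm_mul]
  refine mul_le_mul_of_nonneg_right ?_ (norm_nonneg _)
  refine (norm_add_le _ _).trans ?_
  have h1 : (k : ℝ) ≤ 2 ^ k := by exact_mod_cast k.lt_two_pow_self.le
  have h2 : (1 : ℝ) ≤ 2 ^ k := one_le_pow₀ (by norm_num)
  simp only [norm_mul, Complex.norm_ofNat, Complex.norm_natCast]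
  nlinarith [norm_nonneg ν]

theorem EntireCoeff.hasDerivAt_cpow_mul {e : ℕ → ℂ} (h : EntireCoeff e) (ν : ℂ) {y : ℝ}
    (hy : 0 < y) :
    HasDerivAt (fun y : ℝ => (y : ℂ) ^ ν * ∑' k, e k * ((y : ℂ) ^ 2) ^ k)
      ((y : ℂ) ^ (ν - 1) * ∑' k : ℕ, (ν + 2 * k) * e k * ((y : ℂ) ^ 2) ^ k) y := by
  have hy0 : (y : ℂ) ≠ 0 := by exact_mod_cast hy.ne'
  have hd : HasDerivAt (fun z : ℂ => z ^ ν * ∑' k, e k * (z ^ 2) ^ k)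
      (ν * (y : ℂ) ^ (ν - 1) * 1 * ∑' k, e k * ((y : ℂ) ^ 2) ^ k + (y : ℂ) ^ ν *
        ((∑' k : ℕ, e k * (k * ((y : ℂ) ^ 2) ^ (k - 1))) * ((2 : ℕ) * (y : ℂ) ^ (2 - 1)))) y := by
    refine HasDerivAt.mul ?_ ?_
    · exact (hasDerivAt_id (y : ℂ)).cpow_const (Or.inl (by simpa using hy))
    · exact (h.hasDerivAt ((y : ℂ) ^ 2)).comp (y : ℂ) (hasDerivAt_pow 2 (y : ℂ))
  refine hd.comp_ofReal.congr_deriv ?_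
  have hs := h.summable ((y : ℂ) ^ 2)
  have hl := (h.linear_mul ν).summable ((y : ℂ) ^ 2)
  have hs2 : Summable fun k : ℕ => 2 * k * e k * ((y : ℂ) ^ 2) ^ k := by
    refine (hl.sub (hs.mul_left ν)).congr fun k => ?_
    ring
  have e1 : (y : ℂ) ^ ν = (y : ℂ) ^ (ν - 1) * y := by
    rw [Complex.cpow_sub _ _ hy0, Complex.cpow_one, div_mul_cancel₀ _ hy0]
  have e2 : (y : ℂ) * ((∑' k : ℕ, e k * (k * ((y : ℂ) ^ 2) ^ (k - 1))) *
      ((2 : ℕ) * (y : ℂ) ^ (2 - 1))) = ∑' k : ℕ, 2 * k * e k * ((y : ℂ) ^ 2) ^ k := by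
    rw [← tsum_mul_right, ← tsum_mul_left]
    refine tsum_congr fun k => ?_
    rcases k with _ | k
    · simp
    · simp only [Nat.add_sub_cancel, pow_succ ((y : ℂ) ^ 2) k]
      push_cast
      ring
  have e3 : ∑' k : ℕ, (ν + 2 * k) * e k * ((y : ℂ) ^ 2) ^ k =
      ν * ∑' k, e k * ((y : ℂ) ^ 2) ^ k + ∑' k : ℕ, 2 * k * e k * ((y : ℂ) ^ 2) ^ k := by
    rw [← tsum_mul_left, ← (hs.mul_left ν).tsum_add hs2]
    exact tsum_congr fun k => by ring
  rw [e1, e3, mul_assoc _ (y : ℂ), e2]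
  ring

theorem EntireCoeff.poch_mul {e : ℕ → ℂ} (h : EntireCoeff e) (τ : ℂ) (n : ℕ) :
    EntireCoeff fun k => poch (τ + 2 * k) n * e k := by
  induction n with
  | zero => simpa using h
  | succ n ih =>
    convert ih.linear_mul (τ + n) using 2 with k
    rw [poch_succ]
    ring

/-- Each `y ^ (ν + 2k)` acquires the falling product from `ν + 2k` down to `ν + 2k - n + 1`, which
is a rising factorial read from its last factor. -/
theorem EntireCoeff.iteratedDeriv_cpow_mul {e : ℕ → ℂ} (h : EntireCoeff e) (ν : ℂ) (n : ℕ) {y : ℝ}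
    (hy : 0 < y) :
    iteratedDeriv n (fun y : ℝ => (y : ℂ) ^ ν * ∑' k, e k * ((y : ℂ) ^ 2) ^ k) y =
      (y : ℂ) ^ (ν - n) * ∑' k : ℕ, poch (ν - n + 1 + 2 * k) n * e k * ((y : ℂ) ^ 2) ^ k := by
  induction n generalizing y with
  | zero => simp
  | succ n ih =>
    rw [iteratedDeriv_succ]
    have hev : iteratedDeriv n (fun y : ℝ => (y : ℂ) ^ ν * ∑' k, e k * ((y : ℂ) ^ 2) ^ k) =ᶠ[𝓝 y]
        fun y : ℝ => (y : ℂ) ^ (ν - n) *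
          ∑' k : ℕ, poch (ν - n + 1 + 2 * k) n * e k * ((y : ℂ) ^ 2) ^ k := by
      filter_upwards [lt_mem_nhds hy] with z hz using ih hz
    rw [hev.deriv_eq, ((h.poch_mul (ν - n + 1) n).hasDerivAt_cpow_mul (ν - n) hy).deriv]
    push_cast
    congr 1
    · ring_nf
    · refine tsum_congr fun k => ?_
      rw [poch_succ', show ν - (n + 1) + 1 + 2 * (k : ℂ) = ν - n + 2 * k by ring,
        show ν - n + 2 * (k : ℂ) + 1 = ν - n + 1 + 2 * k by ring]
      ring

theorem EntireCoeff.contDiffAt_cpow_mul {e : ℕ → ℂ} (h : EntireCoeff e) (ν : ℂ) (n : ℕ) {y : ℝ}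
    (hy : 0 < y) :
    ContDiffAt ℝ n (fun y : ℝ => (y : ℂ) ^ ν * ∑' k, e k * ((y : ℂ) ^ 2) ^ k) y := by
  have hd : Differentiable ℂ fun w => ∑' k, e k * w ^ k := fun w =>
    (h.hasDerivAt w).differentiableAt
  have h1 : ContDiffAt ℂ n (fun z : ℂ => z ^ ν * ∑' k, e k * (z ^ 2) ^ k) y := by
    refine ContDiffAt.mul ?_ ?_
    · exact (analyticAt_id.cpow analyticAt_const (by simpa using hy)).contDiffAt
    · exact (hd.comp (differentiable_pow 2)).contDiff.contDiffAt
  exact (h1.restrict_scalars ℝ).comp y Complex.ofRealCLM.contDiff.contDiffAt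

end Derivative

/-! ### Scaling to the unit interval and termwise integration. -/

section Scaling

open MeasureTheory

variable {r : ℝ}

theorem msmIntegrand_mul (L L' X X' G : ℂ) (f : ℝ → ℂ) {y u : ℝ} (hy : 0 < y)
    (hu : u ∈ Set.Ioo (0 : ℝ) 1) :
    msmIntegrand L L' X X' G f y (y * u) =
      (y : ℂ) ^ (G - L' - 1) * (msmKernel L L' X X' G u * f (y * u)) := by
  have h1 : 0 ≤ 1 - u := by linarith [hu.2]
  have hy0 : (y : ℂ) ≠ 0 := by exact_mod_cast hy.ne'
  have e1 : ((y - y * u : ℝ) : ℂ) = (y : ℂ) * ((1 - u : ℝ) : ℂ) := by push_cast; ring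
  have e2 : 1 - y * u / y = 1 - u := by field_simp
  have e3 : 1 - y / (y * u) = 1 - 1 / u := by
    rw [mul_comm, div_mul_cancel_right₀ hy.ne', one_div]
  have e4 : (y : ℂ) ^ (G - L' - 1) = (y : ℂ) ^ (G - 1) * (y : ℂ) ^ (-L') := by
    rw [← Complex.cpow_add _ _ hy0]; ring_nf
  rw [msmIntegrand, msmKernel, e1, e2, e3, e4, Complex.ofReal_mul y u,
    Complex.mul_cpow_ofReal_nonneg hy.le h1, Complex.mul_cpow_ofReal_nonneg hy.le hu.1.le]
  ring

theorem integrableOn_msmKernel_mul (L L' X X' G : ℂ) (f : ℝ → ℂ) {y : ℝ} (hy : 0 < y)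
    (h : MSMIntegralExists L L' X X' G f y) :
    IntegrableOn (fun u : ℝ => msmKernel L L' X X' G u * f (y * u)) (Set.Ioo 0 1) := by
  have hy0 : (y : ℂ) ≠ 0 := by exact_mod_cast hy.ne'
  have h1 := (intervalIntegrable_iff_integrableOn_Ioo_of_le hy.le).2 h
  have h2 := h1.comp_mul_left (c := y)
  rw [zero_div, div_self hy.ne', intervalIntegrable_iff_integrableOn_Ioo_of_le zero_le_one] at h2
  refine IntegrableOn.congr_fun (h2.const_mul ((y : ℂ) ^ (G - L' - 1))⁻¹) (fun u hu => ?_)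
    measurableSet_Ioo
  have h0 : (y : ℂ) ^ (G - L' - 1) ≠ 0 := by
    rw [Complex.cpow_ne_zero_iff]; exact Or.inl hy0
  simp only [msmIntegrand_mul L L' X X' G f hy hu]
  rw [inv_mul_cancel_left₀ h0]

theorem integral_msmIntegrand (L L' X X' G : ℂ) (f : ℝ → ℂ) {y : ℝ} (hy : 0 < y) :
    ∫ t in Set.Ioo 0 y, msmIntegrand L L' X X' G f y t =
      (y : ℂ) ^ (G - L') * ∫ u in Set.Ioo (0 : ℝ) 1, msmKernel L L' X X' G u * f (y * u) := by
  have hy0 : (y : ℂ) ≠ 0 := by exact_mod_cast hy.ne'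
  have h := intervalIntegral.smul_integral_comp_mul_left (a := 0) (b := 1)
    (msmIntegrand L L' X X' G f y) y
  rw [mul_zero, mul_one, intervalIntegral.integral_of_le zero_le_one,
    intervalIntegral.integral_of_le hy.le, integral_Ioc_eq_integral_Ioo,
    integral_Ioc_eq_integral_Ioo] at h
  rw [← h, setIntegral_congr_fun measurableSet_Ioo
    (fun u hu => msmIntegrand_mul L L' X X' G f hy hu), integral_const_mul, Complex.real_smul,
    ← mul_assoc]
  congr 1
  nth_rewrite 1 [← Complex.cpow_one (y : ℂ)]
  rw [← Complex.cpow_add _ _ hy0]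
  ring_nf

/-- If `g` times a power series times `u ^ (σ - 1)` is integrable near `0`, then so is `g` times the
lowest power that occurs. -/
theorem exists_integrableOn_cpow_mul_of_series {g : ℝ → ℂ} {T : ℝ}
    (hT : ∀ s : ℂ, T ≤ s.re → IntegrableOn (fun u : ℝ => (u : ℂ) ^ (s - 1) * g u) (Set.Ioo 0 1))
    {d : ℕ → ℂ} (hd : EntireCoeff d) (σ : ℂ) {x : ℝ} (hx : 0 < x) {f : ℝ → ℂ}
    (hf : ∀ t : ℝ, 0 < t → f t = (t : ℂ) ^ (σ - 1) * ∑' k, d k * ((t : ℂ) ^ 2) ^ k)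
    (hint : IntegrableOn (fun u : ℝ => g u * f (x * u)) (Set.Ioo 0 1)) :
    ∃ r : ℝ, IntegrableOn (fun u : ℝ => (u : ℂ) ^ ((r : ℂ) - 1) * g u) (Set.Ioo 0 1) ∧
      ∀ k, d k ≠ 0 → r ≤ (σ + 2 * k).re := by
  classical
  by_cases hall : ∀ k, d k = 0
  -- For the zero series any exponent with an integrable kernel will do.
  · exact ⟨T, hT T (by simp), fun k hk => absurd (hall k) hk⟩
  push Not at hall
  set k₀ := Nat.find hall with hk₀
  have hk₀d : d k₀ ≠ 0 := Nat.find_spec hall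
  have hk₀min : ∀ k < k₀, d k = 0 := fun k hk => by simpa using Nat.find_min hall hk
  set r : ℝ := (σ + 2 * k₀).re with hr
  refine ⟨r, ?_, fun k hk => ?_⟩
  swap
  · have : k₀ ≤ k := Nat.find_min' hall hk
    have : (k₀ : ℝ) ≤ k := by exact_mod_cast this
    simp [hr]
    linarith
  set h : ℂ → ℂ := fun w => ∑' j, d (j + k₀) * w ^ j with hh
  have hshift : EntireCoeff fun j => d (j + k₀) := by
    intro R hR
    have h1 := (summable_nat_add_iff k₀).2 (hd (R + 1) (by positivity))
    refine Summable.of_nonneg_of_le (fun j => by positivity) (fun j => ?_) h1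
    refine mul_le_mul_of_nonneg_left ?_ (norm_nonneg _)
    exact (pow_le_pow_left₀ hR (by linarith) j).trans
      (pow_le_pow_right₀ (by linarith) (Nat.le_add_right _ _))
  have hfac : ∀ w : ℂ, ∑' k, d k * w ^ k = w ^ k₀ * h w := by
    intro w
    rw [← (hd.summable w).sum_add_tsum_nat_add k₀, Finset.sum_eq_zero, zero_add, hh, ← tsum_mul_left]
    · exact tsum_congr fun j => by rw [pow_add]; ring
    · intro k hk
      rw [hk₀min k (Finset.mem_range.1 hk), zero_mul]
  have hcont : ContinuousAt h 0 := (hshift.hasDerivAt 0).continuousAt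
  have hh0 : h 0 = d k₀ := by
    simp only [hh]
    rw [tsum_eq_single 0 fun j hj => by simp [hj]]
    simp
  have hev : ∀ᶠ u : ℝ in 𝓝 0, ‖d k₀‖ / 2 < ‖h (((x * u : ℝ) : ℂ) ^ 2)‖ := by
    have hc : Tendsto (fun u : ℝ => ‖h (((x * u : ℝ) : ℂ) ^ 2)‖) (𝓝 0) (𝓝 ‖d k₀‖) := by
      rw [← hh0]
      refine (hcont.tendsto.comp ?_).norm
      have : Continuous fun u : ℝ => ((x * u : ℝ) : ℂ) ^ 2 := by fun_prop
      have := this.tendsto 0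
      simpa using this
    exact hc.eventually (lt_mem_nhds (half_lt_self (norm_pos_iff.2 hk₀d)))
  obtain ⟨δ, hδ, hball⟩ := Metric.eventually_nhds_iff.1 hev
  have hTr : IntegrableOn (fun u : ℝ => (u : ℂ) ^ (((max T r : ℝ) : ℂ) - 1) * g u)
    (Set.Ioo 0 1) := hT _ (by simp)
  -- Two majorants: for `u < δ` the cofactor of the lowest power exceeds `‖d k₀‖ / 2`, so `f` itself
  -- dominates `u ^ (r - 1)` up to `c₁`; for `u ≥ δ` a power with a known integral dominates it up
  -- to `c₂`.
  set c₁ : ℝ := (x ^ (r - 1) * (‖d k₀‖ / 2))⁻¹ with hc₁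
  set c₂ : ℝ := δ ^ (r - max T r) with hc₂
  have hnd : 0 < ‖d k₀‖ := norm_pos_iff.2 hk₀d
  have hc₁0 : 0 < c₁ := by positivity
  have hc₂0 : 0 < c₂ := by positivity
  refine Integrable.mono' ((hint.norm.const_mul c₁).add (hTr.norm.const_mul c₂))
    (aestronglyMeasurable_cpow_mul hTr r) ?_
  filter_upwards [ae_restrict_mem measurableSet_Ioo] with u hu
  have hxu : 0 < x * u := mul_pos hx hu.1
  have hxu0 : ((x * u : ℝ) : ℂ) ≠ 0 := by exact_mod_cast hxu.ne'
  simp only [Pi.add_apply]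
  by_cases huδ : u < δ
  · have h1 := hball (y := u) (by simpa [abs_of_pos hu.1] using huδ)
    have e1 : ‖f (x * u)‖ = x ^ (r - 1) * u ^ (r - 1) * ‖h (((x * u : ℝ) : ℂ) ^ 2)‖ := by
      have e2 : ((x * u : ℝ) : ℂ) ^ (σ - 1) * (((x * u : ℝ) : ℂ) ^ 2) ^ k₀ =
          ((x * u : ℝ) : ℂ) ^ (σ + 2 * k₀ - 1) := by
        rw [← pow_mul, ← Complex.cpow_natCast, ← Complex.cpow_add _ _ hxu0]
        push_cast
        ring_nf
      rw [hf _ hxu, hfac, ← mul_assoc, e2, norm_mul, Complex.norm_cpow_eq_rpow_re_of_pos hxu,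
        Real.mul_rpow hx.le hu.1.le, Complex.sub_re, Complex.one_re]
    have h2 : (u : ℝ) ^ (r - 1) ≤ c₁ * ‖f (x * u)‖ := by
      rw [e1, hc₁, inv_mul_eq_div, le_div_iff₀ (by positivity)]
      have : 0 ≤ u ^ (r - 1) := Real.rpow_nonneg hu.1.le _
      have : 0 ≤ x ^ (r - 1) := Real.rpow_nonneg hx.le _
      calc u ^ (r - 1) * (x ^ (r - 1) * (‖d k₀‖ / 2)) =
          x ^ (r - 1) * u ^ (r - 1) * (‖d k₀‖ / 2) := by ring
        _ ≤ _ := by gcongr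
    have h3 : ‖(u : ℂ) ^ ((r : ℂ) - 1) * g u‖ ≤ c₁ * ‖g u * f (x * u)‖ := by
      rw [norm_mul, norm_mul, Complex.norm_cpow_eq_rpow_re_of_pos hu.1]
      simp only [Complex.sub_re, Complex.ofReal_re, Complex.one_re]
      calc _ ≤ (c₁ * ‖f (x * u)‖) * ‖g u‖ := by gcongr
        _ = _ := by ring
    have h4 : 0 ≤ c₂ * ‖(u : ℂ) ^ (((max T r : ℝ) : ℂ) - 1) * g u‖ := by positivity
    linarith
  · push Not at huδ
    have h2 : u ^ (r - 1) ≤ c₂ * u ^ (max T r - 1) := by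
      have h5 : u ^ (r - max T r) ≤ δ ^ (r - max T r) :=
        Real.rpow_le_rpow_of_nonpos hδ huδ (by linarith [le_max_right T r])
      have h6 : u ^ (r - 1) = u ^ (r - max T r) * u ^ (max T r - 1) := by
        rw [← Real.rpow_add hu.1]; ring_nf
      rw [h6]
      exact mul_le_mul_of_nonneg_right h5 (Real.rpow_nonneg hu.1.le _)
    have h3 : ‖(u : ℂ) ^ ((r : ℂ) - 1) * g u‖ ≤
        c₂ * ‖(u : ℂ) ^ (((max T r : ℝ) : ℂ) - 1) * g u‖ := by
      rw [norm_mul, norm_mul, Complex.norm_cpow_eq_rpow_re_of_pos hu.1,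
        Complex.norm_cpow_eq_rpow_re_of_pos hu.1]
      simp only [Complex.sub_re, Complex.ofReal_re, Complex.one_re]
      calc _ ≤ (c₂ * u ^ (max T r - 1)) * ‖g u‖ := by gcongr
        _ = _ := by ring
    have h4 : 0 ≤ c₁ * ‖g u * f (x * u)‖ := by positivity
    linarith

/-- On `(0, 1)` every occurring power is dominated by `u ^ (r - 1)`, so one constant bounds all the
integrals and the entire coefficients give summability. Powers with coefficient `0` may fail to be
integrable and are treated apart. -/
theorem hasSum_integral_mul_series {g : ℝ → ℂ}
    (hr : IntegrableOn (fun u : ℝ => (u : ℂ) ^ ((r : ℂ) - 1) * g u) (Set.Ioo 0 1))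
    {d : ℕ → ℂ} (hd : EntireCoeff d) (σ : ℂ) (hrd : ∀ k, d k ≠ 0 → r ≤ (σ + 2 * k).re)
    {f : ℝ → ℂ} (hf : ∀ t : ℝ, 0 < t → f t = (t : ℂ) ^ (σ - 1) * ∑' k, d k * ((t : ℂ) ^ 2) ^ k)
    {y : ℝ} (hy : 0 < y) :
    HasSum (fun k : ℕ => (y : ℂ) ^ (σ - 1) * ((d k *
      ∫ u in Set.Ioo (0 : ℝ) 1, (u : ℂ) ^ (σ + 2 * k - 1) * g u) * ((y : ℂ) ^ 2) ^ k))
      (∫ u in Set.Ioo (0 : ℝ) 1, g u * f (y * u)) := by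
  set F : ℕ → ℝ → ℂ := fun k u => (y : ℂ) ^ (σ - 1) * (d k * ((y : ℂ) ^ 2) ^ k) *
    ((u : ℂ) ^ (σ + 2 * k - 1) * g u) with hF
  have hFint : ∀ k, IntegrableOn (F k) (Set.Ioo 0 1) := by
    intro k
    by_cases hk : d k = 0
    · simp only [hF, hk, zero_mul, mul_zero]
      exact integrableOn_zero
    · exact (integrableOn_cpow_mul hr (hrd k hk)).const_mul _
  set B := ∫ u in Set.Ioo (0 : ℝ) 1, ‖(u : ℂ) ^ ((r : ℂ) - 1) * g u‖ with hB
  have hFs : Summable fun k => ∫ u in Set.Ioo (0 : ℝ) 1, ‖F k u‖ := by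
    refine Summable.of_nonneg_of_le (fun k => integral_nonneg fun _ => norm_nonneg _) (fun k => ?_)
      ((hd (y ^ 2) (by positivity)).mul_left (‖(y : ℂ) ^ (σ - 1)‖ * B))
    simp only [hF, norm_mul _ (_ * g _), integral_const_mul]
    by_cases hk : d k = 0
    · simp [hk]
    · have h1 := integral_norm_cpow_mul_le hr (hrd k hk)
      have e : ‖(y : ℂ) ^ (σ - 1) * (d k * ((y : ℂ) ^ 2) ^ k)‖ =
          ‖(y : ℂ) ^ (σ - 1)‖ * (‖d k‖ * (y ^ 2) ^ k) := by
        simp [abs_of_pos hy]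
      rw [e]
      calc _ ≤ ‖(y : ℂ) ^ (σ - 1)‖ * (‖d k‖ * (y ^ 2) ^ k) * B := by gcongr
        _ = _ := by ring
  have hFhas : ∀ᵐ u ∂(volume.restrict (Set.Ioo (0 : ℝ) 1)),
      HasSum (fun k => F k u) (g u * f (y * u)) := by
    filter_upwards [ae_restrict_mem measurableSet_Ioo] with u hu
    have hu0 : (u : ℂ) ≠ 0 := by exact_mod_cast hu.1.ne'
    have h := (hd.summable (((y * u : ℝ) : ℂ) ^ 2)).hasSum.mul_left
      (g u * ((y * u : ℝ) : ℂ) ^ (σ - 1))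
    rw [hf _ (mul_pos hy hu.1), ← mul_assoc]
    have e : (fun k => F k u) = fun k => g u * ((y * u : ℝ) : ℂ) ^ (σ - 1) *
        (d k * (((y * u : ℝ) : ℂ) ^ 2) ^ k) := by
      ext k
      have e2 : (u : ℂ) ^ (σ + 2 * k - 1) = (u : ℂ) ^ (σ - 1) * ((u : ℂ) ^ 2) ^ k := by
        rw [← pow_mul, ← Complex.cpow_natCast, ← Complex.cpow_add _ _ hu0]
        push_cast
        ring_nf
      simp only [hF]
      rw [e2, Complex.ofReal_mul, Complex.mul_cpow_ofReal_nonneg hy.le hu.1.le, mul_pow, mul_pow]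
      ring
    rw [e]
    exact h
  convert (integrable_and_hasSum_integral hFint hFs hFhas).2 using 2 with k
  simp only [hF, integral_const_mul]
  ring

end Scaling

/-! ### The image formula. -/

section Main

open MeasureTheory

theorem msmIntegral_series (L L' X X' G : ℂ) {r : ℝ}
    (hr : IntegrableOn (fun u : ℝ => (u : ℂ) ^ ((r : ℂ) - 1) * msmKernel L L' X X' G u)
      (Set.Ioo 0 1)) {d : ℕ → ℂ} (hd : EntireCoeff d) (σ : ℂ)
    (hrd : ∀ k, d k ≠ 0 → r ≤ (σ + 2 * k).re) {f : ℝ → ℂ}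
    (hf : ∀ t : ℝ, 0 < t → f t = (t : ℂ) ^ (σ - 1) * ∑' k, d k * ((t : ℂ) ^ 2) ^ k)
    {y : ℝ} (hy : 0 < y) :
    msmIntegral L L' X X' G f y = (y : ℂ) ^ (G - L - L' + σ - 1) * ∑' k : ℕ, (d k *
      ∫ u in Set.Ioo (0 : ℝ) 1, (u : ℂ) ^ (σ + 2 * k - 1) * msmKernel L L' X X' G u) /
        Complex.Gamma G * ((y : ℂ) ^ 2) ^ k := by
  have hy0 : (y : ℂ) ≠ 0 := by exact_mod_cast hy.ne'
  rw [msmIntegral, integral_msmIntegrand L L' X X' G f hy,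
    ← (hasSum_integral_mul_series hr hd σ hrd hf hy).tsum_eq, tsum_mul_left,
    show G - L - L' + σ - 1 = -L + (G - L') + (σ - 1) by ring, Complex.cpow_add _ _ hy0,
    Complex.cpow_add _ _ hy0]
  simp only [div_mul_eq_mul_div, tsum_div_const]
  ring

theorem entireCoeff_mul_integral {g : ℝ → ℂ} {r : ℝ}
    (hr : IntegrableOn (fun u : ℝ => (u : ℂ) ^ ((r : ℂ) - 1) * g u) (Set.Ioo 0 1))
    {d : ℕ → ℂ} (hd : EntireCoeff d) (σ w : ℂ) (hrd : ∀ k, d k ≠ 0 → r ≤ (σ + 2 * k).re) :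
    EntireCoeff fun k : ℕ => (d k *
      ∫ u in Set.Ioo (0 : ℝ) 1, (u : ℂ) ^ (σ + 2 * k - 1) * g u) / w := by
  refine hd.of_norm_le (Q := 1) zero_le_one
    (B := (∫ u in Set.Ioo (0 : ℝ) 1, ‖(u : ℂ) ^ ((r : ℂ) - 1) * g u‖) / ‖w‖) fun k => ?_
  by_cases hk : d k = 0
  · simp [hk]
  · have h1 := (norm_integral_le_integral_norm _).trans (integral_norm_cpow_mul_le hr (hrd k hk))
    rw [norm_div, norm_mul, one_pow, mul_one]
    calc _ ≤ ‖d k‖ * (∫ u in Set.Ioo (0 : ℝ) 1, ‖(u : ℂ) ^ ((r : ℂ) - 1) * g u‖) / ‖w‖ := by gcongr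
      _ = _ := by ring

/-- The coefficients of `t ↦ t ^ (-(p + 1)) W(t)` as a power series in `t ^ 2`. -/
noncomputable def struveCoeff (a : ℕ) (α : ℝ) (μ p b c : ℂ) (η : ℝ) (k : ℕ) : ℂ :=
  (-c) ^ k * ((Complex.Gamma (α * k + μ))⁻¹ *
    (Complex.Gamma (a * k + (p / η + (b + 2) / 2)))⁻¹) * (1 / 4) ^ k / 2 ^ (p + 1)

theorem entireCoeff_struveCoeff (a : ℕ) {α : ℝ} (hα : 0 < α) (μ p b c : ℂ) (η : ℝ) :
    EntireCoeff (struveCoeff a α μ p b c η) := by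
  refine (entireCoeff_struve a hα μ (p / η + (b + 2) / 2) c).of_norm_le
    (B := ‖(2 : ℂ) ^ (p + 1)‖⁻¹) (Q := 1 / 4) (by norm_num) fun k => le_of_eq ?_
  simp only [struveCoeff, norm_mul, norm_div, norm_pow, norm_one, RCLike.norm_ofNat]
  ring

theorem cpow_mul_genStruve (a : ℕ) (α : ℝ) (μ p b c ρ : ℂ) (η : ℝ) {t : ℝ} (ht : 0 < t) :
    (t : ℂ) ^ (ρ - 1) * genStruve a α μ p b c η t =
      (t : ℂ) ^ (ρ + p + 1 - 1) * ∑' k, struveCoeff a α μ p b c η k * ((t : ℂ) ^ 2) ^ k := by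
  have ht0 : (t : ℂ) ≠ 0 := by exact_mod_cast ht.ne'
  have h2 : (2 : ℂ) ^ (p + 1) ≠ 0 := by simp
  rw [genStruve, ← tsum_mul_left, ← tsum_mul_left]
  refine tsum_congr fun k => ?_
  have e1 : ((t : ℂ) / 2) ^ (2 * (k : ℂ) + p + 1) =
      (t : ℂ) ^ (p + 1) / 2 ^ (p + 1) * (((t : ℂ) ^ 2) ^ k * (1 / 4) ^ k) := by
    have h3 : ((t : ℂ) / 2) ≠ 0 := div_ne_zero ht0 two_ne_zero
    have h4 : (t : ℂ) ^ (p + 1) = ((t : ℂ) / 2) ^ (p + 1) * 2 ^ (p + 1) := by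
      have := Complex.mul_cpow_ofReal_nonneg (a := t / 2) (b := 2) (by positivity) (by norm_num)
        (p + 1)
      push_cast at this
      rw [← this]
      congr 1
      ring
    rw [add_assoc, add_comm, Complex.cpow_add _ _ h3, h4, mul_div_cancel_right₀ _ h2, ← mul_pow]
    congr 1
    rw [show (2 : ℂ) * k = ((2 * k : ℕ) : ℂ) by push_cast; ring, Complex.cpow_natCast, pow_mul]
    congr 1
    ring
  have e2 : (t : ℂ) ^ (ρ + p + 1 - 1) = (t : ℂ) ^ (ρ - 1) * (t : ℂ) ^ (p + 1) := by
    rw [← Complex.cpow_add _ _ ht0]; ring_nf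
  rw [e1, e2, struveCoeff, add_assoc ((a : ℂ) * k), div_eq_mul_inv, mul_inv]
  ring

theorem foxWrightTerm_upperParams_lowerParams (l l' ξ ξ' γ ρ p b μ : ℂ) (α η : ℝ) (a : ℕ) (z : ℂ)
    (k : ℕ) :
    foxWrightTerm (upperParams l l' ξ ξ' γ ρ p) (lowerParams l l' ξ ξ' γ ρ p b μ α η a) z k =
      Complex.Gamma (ρ + p + 1 + 2 * k) * Complex.Gamma (-ξ + l + ρ + p + 1 + 2 * k) *
        Complex.Gamma (l + l' + ξ' - γ + ρ + p + 1 + 2 * k) *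
      ((Complex.Gamma (α * k + μ))⁻¹ * (Complex.Gamma (a * k + (p / η + (b + 2) / 2)))⁻¹ *
        (Complex.Gamma (-ξ + ρ + p + 1 + 2 * k))⁻¹ *
        (Complex.Gamma (l + l' - γ + ρ + p + 1 + 2 * k))⁻¹ *
        (Complex.Gamma (l + ξ' - γ + ρ + p + 1 + 2 * k))⁻¹) * z ^ k := by
  have hk : (k.factorial : ℂ) ≠ 0 := by exact_mod_cast k.factorial_ne_zero
  have h1 : Complex.Gamma (1 + k) = k.factorial := by
    rw [add_comm, Complex.Gamma_nat_eq_factorial]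
  simp only [foxWrightTerm, upperParams, lowerParams, Fin.prod_univ_succ]
  simp only [Fin.prod_univ_zero, Matrix.cons_val_zero, Matrix.cons_val_succ, Complex.ofReal_one,
    Complex.ofReal_ofNat, Complex.ofReal_natCast, one_mul, mul_one, h1]
  rw [add_comm μ, add_comm (p / η + (b + 2) / 2) ((a : ℂ) * k)]
  simp only [div_eq_mul_inv, mul_inv]
  field_simp

/-- The numerator Gammas are nonzero, so the moment identity `hM` can be solved for `M`; then `poch`
cancels the shift by `n` in `1 / Γ(l + l' - γ + ρ + p + 1 + 2k + n)`. -/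
theorem foxWrightTerm_eq_coeff {l l' ξ ξ' γ ρ p b c μ : ℂ} {a n : ℕ} {α η : ℝ} {G M : ℂ}
    (hG : Complex.Gamma G ≠ 0) (hright : FoxWrightTermsExist (upperParams l l' ξ ξ' γ ρ p)) (k : ℕ)
    (hM : struveCoeff a α μ p b c η k ≠ 0 → M * ((Complex.Gamma (ρ + p + 1 + 2 * k))⁻¹ *
        (Complex.Gamma (-ξ + l + ρ + p + 1 + 2 * k))⁻¹ *
        (Complex.Gamma (l + l' + ξ' - γ + ρ + p + 1 + 2 * k))⁻¹) =
      Complex.Gamma G * ((Complex.Gamma (-ξ + ρ + p + 1 + 2 * k))⁻¹ *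
        (Complex.Gamma (l + l' - γ + ρ + p + 1 + 2 * k + n))⁻¹ *
        (Complex.Gamma (l + ξ' - γ + ρ + p + 1 + 2 * k))⁻¹)) (w : ℂ) :
    poch (l + l' - γ + ρ + p + 1 + 2 * k) n * (struveCoeff a α μ p b c η k * M / Complex.Gamma G) *
        w ^ k =
      (2 ^ (p + 1))⁻¹ * foxWrightTerm (upperParams l l' ξ ξ' γ ρ p)
        (lowerParams l l' ξ ξ' γ ρ p b μ α η a) (-c * w / 4) k := by
  have hne : ∀ {s : ℂ}, (∀ j : ℕ, s ≠ -(j : ℂ)) → Complex.Gamma s ≠ 0 := Complex.Gamma_ne_zero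
  have g1 : Complex.Gamma (ρ + p + 1 + 2 * k) ≠ 0 :=
    hne fun j => by simpa [upperParams] using hright 1 k j
  have g2 : Complex.Gamma (-ξ + l + ρ + p + 1 + 2 * k) ≠ 0 :=
    hne fun j => by simpa [upperParams] using hright 2 k j
  have g3 : Complex.Gamma (l + l' + ξ' - γ + ρ + p + 1 + 2 * k) ≠ 0 :=
    hne fun j => by simpa [upperParams] using hright 3 k j
  rw [foxWrightTerm_upperParams_lowerParams,
    Gamma_inv_eq_poch_mul (l + l' - γ + ρ + p + 1 + 2 * k) n,
    show -c * w / 4 = -c * (1 / 4) * w by ring, mul_pow, mul_pow]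
  -- When the coefficient vanishes nothing is known about `M`, but the Fox–Wright term contains the
  -- same vanishing product of `(-c) ^ k` and reciprocal Gammas.
  by_cases hd : struveCoeff a α μ p b c η k = 0
  · rw [hd]
    have h2 : (2 : ℂ) ^ (p + 1) ≠ 0 := by simp
    have hd' := hd
    rw [struveCoeff, div_eq_zero_iff, or_iff_left h2] at hd'
    rw [zero_mul, zero_div, mul_zero, zero_mul]
    linear_combination (-(2 ^ (p + 1))⁻¹ * (Complex.Gamma (ρ + p + 1 + 2 * k) *
      Complex.Gamma (-ξ + l + ρ + p + 1 + 2 * k) *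
      Complex.Gamma (l + l' + ξ' - γ + ρ + p + 1 + 2 * k)) *
      ((Complex.Gamma (-ξ + ρ + p + 1 + 2 * k))⁻¹ * (poch (l + l' - γ + ρ + p + 1 + 2 * k) n *
        (Complex.Gamma (l + l' - γ + ρ + p + 1 + 2 * k + n))⁻¹) *
        (Complex.Gamma (l + ξ' - γ + ρ + p + 1 + 2 * k))⁻¹) * w ^ k) * hd'
  · have hM' : M / Complex.Gamma G = Complex.Gamma (ρ + p + 1 + 2 * k) *
        Complex.Gamma (-ξ + l + ρ + p + 1 + 2 * k) *
        Complex.Gamma (l + l' + ξ' - γ + ρ + p + 1 + 2 * k) *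
        ((Complex.Gamma (-ξ + ρ + p + 1 + 2 * k))⁻¹ *
        (Complex.Gamma (l + l' - γ + ρ + p + 1 + 2 * k + n))⁻¹ *
        (Complex.Gamma (l + ξ' - γ + ρ + p + 1 + 2 * k))⁻¹) := by
      rw [div_eq_iff hG, mul_assoc, mul_comm _ (Complex.Gamma G), ← hM hd]
      field_simp
    rw [mul_div_assoc, hM', struveCoeff]
    ring

theorem theorem3 (l l' ξ ξ' γ ρ p b c μ : ℂ) (a : ℕ) (α η : ℝ)
    (hγ : 0 < γ.re) (hα : 0 < α) (hη : 0 < η) (x : ℝ) (hx : 0 < x)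
    (hleft : ∀ᶠ y in 𝓝 x, MSMDerivInnerExists l l' ξ ξ' γ
      (fun t : ℝ => (t : ℂ) ^ (ρ - 1) * genStruve a α μ p b c η t) y)
    (hright : FoxWrightTermsExist (upperParams l l' ξ ξ' γ ρ p)) :
    ContDiffAt ℝ (msmOrder γ)
        (msmDerivInner l l' ξ ξ' γ
          (fun t : ℝ => (t : ℂ) ^ (ρ - 1) * genStruve a α μ p b c η t)) x ∧
      Summable (foxWrightTerm (upperParams l l' ξ ξ' γ ρ p)
        (lowerParams l l' ξ ξ' γ ρ p b μ α η a) (-c * (x : ℂ) ^ 2 / 4)) ∧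
      msmDeriv l l' ξ ξ' γ
          (fun t : ℝ => (t : ℂ) ^ (ρ - 1) * genStruve a α μ p b c η t) x =
        (x : ℂ) ^ (l + l' - γ + ρ + p) / 2 ^ (p + 1) *
          foxWright (upperParams l l' ξ ξ' γ ρ p)
            (lowerParams l l' ξ ξ' γ ρ p b μ α η a) (-c * (x : ℂ) ^ 2 / 4) := by
  set n := msmOrder γ with hn
  set f : ℝ → ℂ := fun t : ℝ => (t : ℂ) ^ (ρ - 1) * genStruve a α μ p b c η t with hfdef
  set σ : ℂ := ρ + p + 1 with hσ
  set d := struveCoeff a α μ p b c η with hddef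
  have hG : 0 < (-γ + n).re := by
    have := Nat.lt_floor_add_one γ.re
    rw [hn, msmOrder]
    simp
    linarith
  have hGn := Complex.Gamma_ne_zero_of_re_pos hG
  have hd : EntireCoeff d := entireCoeff_struveCoeff a hα μ p b c η
  have hf : ∀ t : ℝ, 0 < t → f t = (t : ℂ) ^ (σ - 1) * ∑' k, d k * ((t : ℂ) ^ 2) ^ k :=
    fun t ht => cpow_mul_genStruve a α μ p b c ρ η ht
  obtain ⟨T, hT⟩ := exists_integrableOn_and_integral_msmKernel (-l') (-l) (-ξ' + n) (-ξ) hG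
  -- Convergence at `x` yields a condition on the kernel that no longer involves `x`, so the
  -- expansion below holds at every `y > 0`.
  obtain ⟨r, hr, hrd⟩ := exists_integrableOn_cpow_mul_of_series (fun s hs => (hT s hs).1) hd σ hx hf
    (integrableOn_msmKernel_mul _ _ _ _ _ f hx hleft.self_of_nhds)
  set e : ℕ → ℂ := fun k => (d k * ∫ u in Set.Ioo (0 : ℝ) 1, (u : ℂ) ^ (σ + 2 * k - 1) *
    msmKernel (-l') (-l) (-ξ' + n) (-ξ) (-γ + n) u) / Complex.Gamma (-γ + n) with hedef
  have he : EntireCoeff e := entireCoeff_mul_integral hr hd σ _ hrd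
  set ν : ℂ := -γ + n - -l' - -l + σ - 1 with hν
  have hinner : msmDerivInner l l' ξ ξ' γ f =ᶠ[𝓝 x]
      fun y : ℝ => (y : ℂ) ^ ν * ∑' k, e k * ((y : ℂ) ^ 2) ^ k := by
    filter_upwards [lt_mem_nhds hx] with y hy
    exact msmIntegral_series _ _ _ _ _ hr hd σ hrd hf hy
  have hterm : ∀ k : ℕ, poch (ν - n + 1 + 2 * k) n * e k * ((x : ℂ) ^ 2) ^ k =
      (2 ^ (p + 1))⁻¹ * foxWrightTerm (upperParams l l' ξ ξ' γ ρ p)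
        (lowerParams l l' ξ ξ' γ ρ p b μ α η a) (-c * (x : ℂ) ^ 2 / 4) k := by
    intro k
    rw [← foxWrightTerm_eq_coeff (n := n) (M := ∫ u in Set.Ioo (0 : ℝ) 1,
      (u : ℂ) ^ (σ + 2 * k - 1) * msmKernel (-l') (-l) (-ξ' + n) (-ξ) (-γ + n) u) hGn hright k ?_]
    · rw [show ν - n + 1 + 2 * (k : ℂ) = l + l' - γ + ρ + p + 1 + 2 * k by rw [hν, hσ]; ring]
    · intro hk
      -- With these parameters the `n` in `G = -γ + n` cancels that in `X = -ξ' + n`, except in `Γ(s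
      -- + G - L' - L)`.
      have h := integral_msmKernel_mul (-l') (-l) (-ξ' + n) (-ξ) hG hr (hrd k hk)
      convert h using 4
      all_goals
        rw [hσ]
        ring_nf
  have h2 : (2 : ℂ) ^ (p + 1) ≠ 0 := by simp
  refine ⟨(he.contDiffAt_cpow_mul ν n hx).congr_of_eventuallyEq hinner, ?_, ?_⟩
  · have hs := ((he.poch_mul (ν - n + 1) n).summable ((x : ℂ) ^ 2)).mul_left (2 ^ (p + 1))
    refine hs.congr fun k => ?_
    rw [hterm, mul_inv_cancel_left₀ h2]
  · rw [msmDeriv, hinner.iteratedDeriv_eq, he.iteratedDeriv_cpow_mul ν n hx, tsum_congr hterm,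
      tsum_mul_left, foxWright, show ν - n = l + l' - γ + ρ + p by rw [hν, hσ]; ring]
    ring

end Main
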